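/- Let $k$ be a field of characteristic zero and let $b\in\mathbb N$. **The category $\mathfrak D$.** Its objects are pairs $(X,Y)$ of finite sets. A morphism $(X,Y)\to(U,V)$ is a triple $(i,j,\zeta)$ of injections $i:X\hookrightarrow U$, $j:Y\hookrightarrow V$ and $\zeta:\{1,2\}\times (V\setminus j(Y))\hookrightarrow U\setminus i(X)$. The composite of $(i,j,\zeta):(X,Y)\to(U,V)$ with $(f,g,\beta):(U,V)\to(W,Z)$ is $(fi,gj,\gamma)$, where $\gamma(\varepsilon,z)=\beta(\varepsilon,z)$ for $z\notin g(V)$ and $\gamma(\varepsilon,g(v))=f(\zeta(\varepsilon,v))$ for $v\in V\setminus j(Y)$. Let $\mathfrak D_0\subset\mathfrak D$ be the wide subcategory of the morphisms for which $\zeta$ is bijective. **The categories $E$ and $E_0$.** Let $\iota,\tau:(X,Y)\to(X\amalg\{1,2\},Y\amalg\{1\})$ be the morphisms of $\mathfrak D$ given by the canonical inclusions together with, respectively, $\zeta(\varepsilon,1)=\varepsilon$ and $\zeta(\varepsilon,1)=3-\varepsilon$. The $k$-linear category $E$ is the quotient of the $k$-linearization $k\mathfrak D$ by the two-sided ideal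 generated by the elements $\iota+\tau$ (for all $(X,Y)$), and $E_0\subset E$ is the image of $k\mathfrak D_0$. An $E$-module (respectively $E_0$-module) is a $k$-linear functor from $E$ (respectively $E_0$) to $k$-modules. Extension by zero is the functor from $E_0$-modules to $E$-modules that keeps the values on objects and the action of the morphisms of $\mathfrak D_0$ and lets the other morphisms of $\mathfrak D$ act by zero; $H^E_{E_0}$ denotes its left adjoint. **Beads.** For finite sets $X,Y$ let $\mathsf{Beads}^{[1,2]}(X,Y)$ be the set of arrangements of the elements (beads) of $X$ into columns indexed by $Y$, such that each column consists of either one bead (in the bottom row) or an ordered pair of beads (one in the bottom row and one in the top row). A morphism $(i,j,\zeta):(X,Y)\to(U,V)$ of $\mathfrak D$ acts on the $k$-linearization by sending an arrangement $\phi$ to the sum of all arrangements of $(U,V)$ in which the beads of $\phi$ keep their places (relabelled by $i$ and $j$), each column $v\in V\setminus j(Y)$ has bottom bead $\zeta(1,v)$ and top bead $\zeta(2,v)$, and the remaining beads of $U$ are placed, in all possible ways, in the free places of the top row of the columns coming from $\phi$. Let $\mathsf{Beads}^{[1,2],\pm}_k(X,Y)$ be the quotient of $k\,\mathsf{Beads}^{[1,2]}(X,Y)$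 by the relations $\phi+t\phi=0$, where $t$ is the transposition of the labels of the two beads of a two-bead column of $\phi$. With the induced action it is an $E$-module. **Schur functors.** For an $E_0$-module $M$, the Schur functor associated to $M(-,\mathbf b)$, where $\mathbf b=\{1,\dots,b\}$, is the functor on finite-dimensional $k$-vector spaces $$V\longmapsto \bigoplus_{n\in\mathbb N}V^{\otimes n}\otimes_{\mathfrak S_n}M(\mathbf n,\mathbf b),\qquad \mathbf n=\{1,\dots,n\},$$ where $\mathfrak S_n$ acts on $V^{\otimes n}$ by place permutations; the group $\mathfrak S_b$ acts on it through the automorphisms of $\mathbf b$. **Lie algebras.** For a $k$-vector space $V$ let $\mathrm{Lie}(V)$ be the free Lie algebra on $V$ and let $\mathrm{Lie}_{\le 2}(V)$ be its quotient by the ideal spanned by the brackets of length at least $3$, considered as a $\mathrm{Lie}(V)$-module for the adjoint action. Then $\mathrm{Lie}(V)$ acts diagonally on $\mathrm{Lie}_{\le2}(V)^{\otimes b}$, and $\mathfrak S_b$ acts on $\mathrm{Lie}_{\le2}(V)^{\otimes b}$ by place permutations. For a Lie algebra $\mathfrak g$ and a $\mathfrak g$-module $N$, $H_0(\mathfrak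 g;N)=N/\mathfrak gN$ is the Lie algebra homology in degree zero. **Proposition.** There is an $\mathfrak S_b$-equivariant isomorphism, natural in the finite-dimensional $k$-vector space $V$, between the Schur functor associated to $H^E_{E_0}\mathsf{Beads}^{[1,2],\pm}_k(-,\mathbf b)$ and the functor $$V\longmapsto H_0\big(\mathrm{Lie}(V);\mathrm{Lie}_{\le 2}(V)^{\otimes b}\big).$$ -/

import Mathlib

open CategoryTheory
open scoped TensorProduct

universe u

noncomputable section

namespace BabyBeads

/-! ## The category `𝔇` of pairs of finite sets -/

/-- A pair `(X, Y)` of finite sets. -/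
structure FinPair where
  X : Type
  Y : Type
  [finX : Finite X]
  [finY : Finite Y]

attribute [instance] FinPair.finX FinPair.finY

/-- A morphism `(X, Y) ⟶ (U, V)` of `𝔇`: injections `i : X ↪ U`, `j : Y ↪ V` and an injection
`ζ : {1, 2} × (V \ j(Y)) ↪ U \ i(X)`. -/
structure DHom (A B : FinPair) where
  i : A.X ↪ B.X
  j : A.Y ↪ B.Y
  ζ : Fin 2 × {v : B.Y // v ∉ Set.range j} ↪ {u : B.X // u ∉ Set.range i}

theorem DHom.ext_of {A B : FinPair} {m n : DHom A B} (hi : ∀ x, m.i x = n.i x)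
    (hj : ∀ y, m.j y = n.j y)
    (hζ : ∀ ε v (h : v ∉ Set.range m.j) (h' : v ∉ Set.range n.j),
      (m.ζ (ε, ⟨v, h⟩) : B.X) = n.ζ (ε, ⟨v, h'⟩)) : m = n := by
  obtain ⟨i, j, ζ⟩ := m
  obtain ⟨i', j', ζ'⟩ := n
  obtain rfl : i = i' := by ext x; exact hi x
  obtain rfl : j = j' := by ext x; exact hj x
  obtain rfl : ζ = ζ' := by
    ext ⟨ε, v, h⟩
    exact hζ ε v h h
  rfl

/-- The identity of `𝔇`. -/
def DHom.id (A : FinPair) : DHom A A where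
  i := Function.Embedding.refl _
  j := Function.Embedding.refl _
  ζ := ⟨fun p => (p.2.2 ⟨p.2.1, rfl⟩).elim, fun p => (p.2.2 ⟨p.2.1, rfl⟩).elim⟩

open Classical in
/-- The third component of a composite in `𝔇`: it is `β` away from the image of `g`, and
`f ζ g⁻¹` on the image of `g`. -/
def DHom.compζ {A B C : FinPair} (m : DHom A B) (n : DHom B C) (ε : Fin 2)
    (z : {z : C.Y // z ∉ Set.range (m.j.trans n.j)}) : C.X :=
  if h : z.1 ∈ Set.range n.j then
    n.i (m.ζ (ε, ⟨h.choose, fun ⟨y, hy⟩ => z.2 ⟨y, by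
      rw [Function.Embedding.trans_apply, hy]; exact h.choose_spec⟩⟩))
  else n.ζ (ε, ⟨z.1, h⟩)

theorem DHom.compζ_of_mem {A B C : FinPair} (m : DHom A B) (n : DHom B C) (ε : Fin 2)
    (v : B.Y) (hv : v ∉ Set.range m.j) (h : n.j v ∉ Set.range (m.j.trans n.j)) :
    DHom.compζ m n ε ⟨n.j v, h⟩ = n.i (m.ζ (ε, ⟨v, hv⟩)) := by
  have hex : n.j v ∈ Set.range n.j := ⟨v, rfl⟩
  have hc : hex.choose = v := n.j.injective hex.choose_spec
  unfold DHom.compζ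
  rw [dif_pos hex]
  congr 4
  exact Subtype.ext hc

theorem DHom.compζ_of_not_mem {A B C : FinPair} (m : DHom A B) (n : DHom B C) (ε : Fin 2)
    (z : C.Y) (hz : z ∉ Set.range n.j) (h : z ∉ Set.range (m.j.trans n.j)) :
    DHom.compζ m n ε ⟨z, h⟩ = n.ζ (ε, ⟨z, hz⟩) := by
  unfold DHom.compζ
  rw [dif_neg hz]

/-- Composition in `𝔇` (in diagrammatic order). -/
def DHom.comp {A B C : FinPair} (m : DHom A B) (n : DHom B C) : DHom A C where
  i := m.i.trans n.i
  j := m.j.trans n.j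
  ζ := ⟨fun p => ⟨DHom.compζ m n p.1 p.2, by
      obtain ⟨ε, z, hz⟩ := p
      by_cases h : z ∈ Set.range n.j
      · obtain ⟨v, rfl⟩ := h
        have hv : v ∉ Set.range m.j := by
          rintro ⟨y, rfl⟩; exact hz ⟨y, rfl⟩
        rw [DHom.compζ_of_mem m n ε v hv hz]
        rintro ⟨x, hx⟩
        exact (m.ζ (ε, ⟨v, hv⟩)).2 ⟨x, n.i.injective hx⟩
      · rw [DHom.compζ_of_not_mem m n ε z h hz]
        rintro ⟨x, hx⟩
        exact (n.ζ (ε, ⟨z, h⟩)).2 ⟨m.i x, hx⟩⟩, by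
    rintro ⟨ε, z, hz⟩ ⟨ε', z', hz'⟩ h
    have h := congrArg Subtype.val h
    dsimp only at h
    by_cases hm : z ∈ Set.range n.j <;> by_cases hm' : z' ∈ Set.range n.j
    · obtain ⟨v, rfl⟩ := hm
      obtain ⟨v', rfl⟩ := hm'
      have hv : v ∉ Set.range m.j := by
        rintro ⟨y, rfl⟩; exact hz ⟨y, rfl⟩
      have hv' : v' ∉ Set.range m.j := by
        rintro ⟨y, rfl⟩; exact hz' ⟨y, rfl⟩
      rw [DHom.compζ_of_mem m n ε v hv hz, DHom.compζ_of_mem m n ε' v' hv' hz'] at h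
      have h2 := m.ζ.injective (Subtype.ext (n.i.injective h))
      simp only [Prod.mk.injEq, Subtype.mk.injEq] at h2
      obtain ⟨rfl, rfl⟩ := h2
      rfl
    · obtain ⟨v, rfl⟩ := hm
      have hv : v ∉ Set.range m.j := by
        rintro ⟨y, rfl⟩; exact hz ⟨y, rfl⟩
      rw [DHom.compζ_of_mem m n ε v hv hz, DHom.compζ_of_not_mem m n ε' z' hm' hz'] at h
      exact ((n.ζ (ε', ⟨z', hm'⟩)).2 ⟨_, h⟩).elim
    · obtain ⟨v', rfl⟩ := hm'
      have hv' : v' ∉ Set.range m.j := by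
        rintro ⟨y, rfl⟩; exact hz' ⟨y, rfl⟩
      rw [DHom.compζ_of_mem m n ε' v' hv' hz', DHom.compζ_of_not_mem m n ε z hm hz] at h
      exact ((n.ζ (ε, ⟨z, hm⟩)).2 ⟨_, h.symm⟩).elim
    · rw [DHom.compζ_of_not_mem m n ε z hm hz, DHom.compζ_of_not_mem m n ε' z' hm' hz'] at h
      have h2 := n.ζ.injective (Subtype.ext h)
      simp only [Prod.mk.injEq, Subtype.mk.injEq] at h2
      obtain ⟨rfl, rfl⟩ := h2
      rfl⟩

theorem DHom.comp_ζ_of_mem {A B C : FinPair} (m : DHom A B) (n : DHom B C) (ε : Fin 2)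
    (v : B.Y) (hv : v ∉ Set.range m.j) (h : n.j v ∉ Set.range (m.comp n).j) :
    ((m.comp n).ζ (ε, ⟨n.j v, h⟩) : C.X) = n.i (m.ζ (ε, ⟨v, hv⟩)) :=
  DHom.compζ_of_mem m n ε v hv h

theorem DHom.comp_ζ_of_not_mem {A B C : FinPair} (m : DHom A B) (n : DHom B C) (ε : Fin 2)
    (z : C.Y) (hz : z ∉ Set.range n.j) (h : z ∉ Set.range (m.comp n).j) :
    ((m.comp n).ζ (ε, ⟨z, h⟩) : C.X) = n.ζ (ε, ⟨z, hz⟩) :=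
  DHom.compζ_of_not_mem m n ε z hz h

/-- The category `𝔇`. -/
instance : Category FinPair where
  Hom := DHom
  id := DHom.id
  comp m n := m.comp n
  id_comp {A B} n := by
    refine DHom.ext_of (fun _ => rfl) (fun _ => rfl) fun ε v h h' => ?_
    exact DHom.comp_ζ_of_not_mem _ _ _ _ h' h
  comp_id {A B} n := by
    refine DHom.ext_of (fun _ => rfl) (fun _ => rfl) fun ε v h h' => ?_
    exact DHom.comp_ζ_of_mem n (DHom.id B) ε v h' h
  assoc {A B C D} m n p := by
    refine DHom.ext_of (fun _ => rfl) (fun _ => rfl) fun ε v h h' => ?_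
    by_cases h1 : v ∈ Set.range p.j
    · obtain ⟨v, rfl⟩ := h1
      have h2 : v ∉ Set.range (m.comp n).j := by
        rintro ⟨y, rfl⟩; exact h ⟨y, rfl⟩
      rw [DHom.comp_ζ_of_mem (m.comp n) p ε v h2 h]
      by_cases h3 : v ∈ Set.range n.j
      · obtain ⟨v, rfl⟩ := h3
        have h4 : v ∉ Set.range m.j := by
          rintro ⟨y, rfl⟩; exact h ⟨y, rfl⟩
        rw [DHom.comp_ζ_of_mem m n ε v h4]
        exact (DHom.comp_ζ_of_mem m (n.comp p) ε v h4 h').symm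
      · have h4 : p.j v ∉ Set.range (n.comp p).j := by
          rintro ⟨y, hy⟩; exact h3 ⟨y, p.j.injective hy⟩
        rw [DHom.comp_ζ_of_not_mem m n ε v h3, DHom.comp_ζ_of_not_mem m (n.comp p) ε _ h4,
          DHom.comp_ζ_of_mem n p ε v h3]
    · have h4 : v ∉ Set.range (n.comp p).j := by
        rintro ⟨y, hy⟩; exact h1 ⟨_, hy⟩
      rw [DHom.comp_ζ_of_not_mem (m.comp n) p ε v h1,
        DHom.comp_ζ_of_not_mem m (n.comp p) ε v h4,
        DHom.comp_ζ_of_not_mem n p ε v h1]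

/-- The morphisms of the wide subcategory `𝔇₀ ⊂ 𝔇`: those for which `ζ` is a bijection. -/
def IsD0 {A B : FinPair} (m : A ⟶ B) : Prop := Function.Bijective m.ζ

/-- The integer `|X| - 2|Y|`. -/
def FinPair.deg (A : FinPair) : ℤ := (Nat.card A.X : ℤ) - 2 * Nat.card A.Y

theorem card_compl {α β : Type} [Finite β] (f : α ↪ β) :
    (Nat.card {b : β // b ∉ Set.range f} : ℤ) = Nat.card β - Nat.card α := by
  classical
  have : Finite α := Finite.of_injective f f.injective
  have := Fintype.ofFinite α
  have := Fintype.ofFinite β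
  have h1 : Nat.card {b : β // b ∉ Set.range f} + Nat.card α = Nat.card β := by
    rw [Nat.card_congr (Equiv.ofInjective f f.injective), add_comm, ← Nat.card_sum]
    exact Nat.card_congr (Equiv.sumCompl (· ∈ Set.range f))
  omega

theorem deg_le {A B : FinPair} (m : A ⟶ B) : A.deg ≤ B.deg := by
  have h := Nat.card_le_card_of_injective _ m.ζ.injective
  have h1 := card_compl m.i
  have h2 := card_compl m.j
  rw [Nat.card_prod, Nat.card_eq_fintype_card, Fintype.card_fin] at h
  unfold FinPair.deg
  zify at h
  linarith

/-- A morphism lies in `𝔇₀` exactly when its source and target have the same degree. -/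
theorem isD0_iff {A B : FinPair} (m : A ⟶ B) : IsD0 m ↔ A.deg = B.deg := by
  have h1 := card_compl m.i
  have h2 := card_compl m.j
  have h3 : (Nat.card (Fin 2 × {v : B.Y // v ∉ Set.range m.j}) : ℤ) =
      2 * Nat.card {v : B.Y // v ∉ Set.range m.j} := by
    rw [Nat.card_prod, Nat.card_eq_fintype_card, Fintype.card_fin]; push_cast; ring
  unfold FinPair.deg IsD0
  constructor
  · intro h
    have h4 := Nat.card_congr (Equiv.ofBijective _ h)
    zify at h4
    linarith
  · intro h
    rw [Nat.bijective_iff_injective_and_card]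
    refine ⟨m.ζ.injective, ?_⟩
    zify
    linarith

theorem isD0_id (A : FinPair) : IsD0 (𝟙 A) := (isD0_iff _).2 rfl

theorem isD0_comp {A B C : FinPair} {m : A ⟶ B} {n : B ⟶ C} (hm : IsD0 m) (hn : IsD0 n) :
    IsD0 (m ≫ n) :=
  (isD0_iff _).2 (((isD0_iff _).1 hm).trans ((isD0_iff _).1 hn))

/-- The morphism of `𝔇₀` given by a pair of bijections. -/
def isoHom {A B : FinPair} (σ : A.X ≃ B.X) (π : A.Y ≃ B.Y) : A ⟶ B where
  i := σ.toEmbedding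
  j := π.toEmbedding
  ζ := ⟨fun p => (p.2.2 ⟨π.symm p.2.1, π.apply_symm_apply _⟩).elim,
    fun p => (p.2.2 ⟨π.symm p.2.1, π.apply_symm_apply _⟩).elim⟩

theorem isD0_isoHom {A B : FinPair} (σ : A.X ≃ B.X) (π : A.Y ≃ B.Y) :
    IsD0 (isoHom σ π) := by
  rw [isD0_iff, FinPair.deg, FinPair.deg, Nat.card_congr σ, Nat.card_congr π]

theorem isoHom_refl (A : FinPair) : isoHom (Equiv.refl A.X) (Equiv.refl A.Y) = 𝟙 A :=
  DHom.ext_of (fun _ => rfl) (fun _ => rfl) fun _ v h _ => (h ⟨v, rfl⟩).elim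

theorem isoHom_comp {A B C : FinPair} (σ : A.X ≃ B.X) (π : A.Y ≃ B.Y)
    (σ' : B.X ≃ C.X) (π' : B.Y ≃ C.Y) :
    isoHom σ π ≫ isoHom σ' π' = isoHom (σ.trans σ') (π.trans π') :=
  DHom.ext_of (fun _ => rfl) (fun _ => rfl) fun _ v _ h =>
    (h ⟨(π.trans π').symm v, (π.trans π').apply_symm_apply _⟩).elim

/-- The pair `(X ⨿ {1, 2}, Y ⨿ {1})`. -/
def FinPair.addColumn (A : FinPair) : FinPair where
  X := A.X ⊕ Fin 2
  Y := A.Y ⊕ Unit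

/-- The morphism `(X, Y) ⟶ (X ⨿ {1, 2}, Y ⨿ {1})` given by the canonical inclusions together with
the bijection `{1, 2} × {1} ≃ {1, 2}, (ε, 1) ↦ s ε`, for a permutation `s` of `{1, 2}`. -/
def addColumnHom (A : FinPair) (s : Equiv.Perm (Fin 2)) : A ⟶ A.addColumn where
  i := ⟨Sum.inl, Sum.inl_injective⟩
  j := ⟨Sum.inl, Sum.inl_injective⟩
  ζ := ⟨fun p => ⟨Sum.inr (s p.1), by rintro ⟨x, hx⟩; exact Sum.inl_ne_inr hx⟩, by
    rintro ⟨ε, v | v, hv⟩ ⟨ε', v' | v', hv'⟩ h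
    · exact (hv ⟨v, rfl⟩).elim
    · exact (hv ⟨v, rfl⟩).elim
    · exact (hv' ⟨v', rfl⟩).elim
    · obtain rfl : ε = ε' := s.injective (Sum.inr_injective (congrArg Subtype.val h))
      rfl⟩

/-- The morphism `ι`. -/
def iotaHom (A : FinPair) : A ⟶ A.addColumn := addColumnHom A 1

/-- The morphism `τ`. -/
def tauHom (A : FinPair) : A ⟶ A.addColumn := addColumnHom A (Equiv.swap 0 1)

/-! ## The `k`-linear categories `E` and `E₀` and their modules -/

variable (k : Type u) [CommRing k]

/-- The degree `(A, B)` part of the two-sided ideal of the `k`-linearization of `𝔇` that is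
generated by the elements `ι + τ`. -/
def antisymIdeal (A B : FinPair) : Submodule k ((A ⟶ B) →₀ k) :=
  Submodule.span k {x | ∃ (P : FinPair) (p : A ⟶ P) (q : P.addColumn ⟶ B),
    x = Finsupp.single (p ≫ iotaHom P ≫ q) 1 + Finsupp.single (p ≫ tauHom P ≫ q) 1}

/-- The `k`-module of morphisms of `E`. -/
abbrev EHom (A B : FinPair) : Type u := ((A ⟶ B) →₀ k) ⧸ antisymIdeal k A B

/-- The class in `E` of a morphism of `𝔇`. -/
def EHom.cls {A B : FinPair} (m : A ⟶ B) : EHom k A B :=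
  (antisymIdeal k A B).mkQ (Finsupp.single m 1)

theorem EHom.span_cls (A B : FinPair) :
    Submodule.span k (Set.range (EHom.cls k (A := A) (B := B))) = ⊤ := by
  rw [eq_top_iff]
  rintro x -
  obtain ⟨x, rfl⟩ := (antisymIdeal k A B).mkQ_surjective x
  induction x using Finsupp.induction_linear with
  | zero => rw [map_zero]; exact Submodule.zero_mem _
  | add x y hx hy => rw [map_add]; exact Submodule.add_mem _ hx hy
  | single m r =>
    rw [← mul_one r, ← smul_eq_mul, ← Finsupp.smul_single, map_smul]
    exact Submodule.smul_mem _ _ (Submodule.subset_span ⟨m, rfl⟩)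

variable {k} in
theorem EHom.induction {A B : FinPair} {p : EHom k A B → Prop} (x : EHom k A B)
    (cls : ∀ m, p (EHom.cls k m)) (zero : p 0) (add : ∀ x y, p x → p y → p (x + y))
    (smul : ∀ (r : k) x, p x → p (r • x)) : p x := by
  have hx : x ∈ Submodule.span k (Set.range (EHom.cls k (A := A) (B := B))) := by
    rw [EHom.span_cls]; trivial
  induction hx using Submodule.span_induction with
  | mem x h => obtain ⟨m, rfl⟩ := h; exact cls m
  | zero => exact zero
  | add x y _ _ hx hy => exact add x y hx hy
  | smul r x _ hx => exact smul r x hx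

variable {k} in
/-- The linear map out of a morphism module of `E` given by a function on the morphisms of `𝔇` that
is compatible with the antisymmetry relations. -/
def EHom.lift {A B : FinPair} {M : Type*} [AddCommGroup M] [Module k M] (f : (A ⟶ B) → M)
    (hf : ∀ (P : FinPair) (p : A ⟶ P) (q : P.addColumn ⟶ B),
      f (p ≫ iotaHom P ≫ q) + f (p ≫ tauHom P ≫ q) = 0) : EHom k A B →ₗ[k] M :=
  (antisymIdeal k A B).liftQ (Finsupp.linearCombination k f) (by
    rw [antisymIdeal, Submodule.span_le]
    rintro _ ⟨P, p, q, rfl⟩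
    simp only [SetLike.mem_coe, LinearMap.mem_ker, map_add, Finsupp.linearCombination_single,
      one_smul]
    exact hf P p q)

variable {k} in
theorem EHom.lift_cls {A B : FinPair} {M : Type*} [AddCommGroup M] [Module k M] (f : (A ⟶ B) → M)
    (hf) (m : A ⟶ B) : EHom.lift (k := k) f hf (EHom.cls k m) = f m := by
  unfold EHom.lift EHom.cls
  rw [Submodule.mkQ_apply, Submodule.liftQ_apply, Finsupp.linearCombination_single, one_smul]

theorem EHom.cls_iota_add_tau {A B : FinPair} (P : FinPair) (p : A ⟶ P) (q : P.addColumn ⟶ B) :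
    EHom.cls k (p ≫ iotaHom P ≫ q) + EHom.cls k (p ≫ tauHom P ≫ q) = 0 := by
  unfold EHom.cls
  rw [← map_add, Submodule.mkQ_apply]
  exact (Submodule.Quotient.mk_eq_zero _).2 (Submodule.subset_span ⟨P, p, q, rfl⟩)

/-- Composition in `E`: the bilinear map induced by the composition of `𝔇`. -/
def EHom.comp (A B C : FinPair) : EHom k A B →ₗ[k] EHom k B C →ₗ[k] EHom k A C :=
  EHom.lift (fun m => EHom.lift (fun n => EHom.cls k (m ≫ n)) fun P p q => by
      have h := EHom.cls_iota_add_tau k P (m ≫ p) q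
      rwa [Category.assoc, Category.assoc] at h) fun P p q => by
    refine LinearMap.ext fun x => ?_
    induction x using EHom.induction with
    | cls n =>
      rw [LinearMap.add_apply, EHom.lift_cls, EHom.lift_cls]
      have h := EHom.cls_iota_add_tau k P p (q ≫ n)
      simpa only [Category.assoc, LinearMap.zero_apply] using h
    | zero => rw [map_zero, map_zero]
    | add x y hx hy => rw [map_add, hx, hy, map_add]
    | smul r x hx => rw [map_smul, hx, map_smul]

theorem EHom.comp_cls {A B C : FinPair} (m : A ⟶ B) (n : B ⟶ C) :
    EHom.comp k A B C (EHom.cls k m) (EHom.cls k n) = EHom.cls k (m ≫ n) := by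
  unfold EHom.comp
  rw [EHom.lift_cls, EHom.lift_cls]

theorem EHom.id_comp {A B : FinPair} (x : EHom k A B) :
    EHom.comp k A A B (EHom.cls k (𝟙 A)) x = x := by
  induction x using EHom.induction with
  | cls n => rw [EHom.comp_cls, Category.id_comp]
  | zero => rw [map_zero]
  | add x y hx hy => rw [map_add, hx, hy]
  | smul r x hx => rw [map_smul, hx]

theorem EHom.comp_id {A B : FinPair} (x : EHom k A B) :
    EHom.comp k A B B x (EHom.cls k (𝟙 B)) = x := by
  induction x using EHom.induction with
  | cls n => rw [EHom.comp_cls, Category.comp_id]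
  | zero => rw [map_zero, LinearMap.zero_apply]
  | add x y hx hy => rw [map_add, LinearMap.add_apply, hx, hy]
  | smul r x hx => rw [map_smul, LinearMap.smul_apply, hx]

theorem EHom.assoc {A B C D : FinPair} (x : EHom k A B) (y : EHom k B C) (z : EHom k C D) :
    EHom.comp k A C D (EHom.comp k A B C x y) z =
      EHom.comp k A B D x (EHom.comp k B C D y z) := by
  induction x using EHom.induction with
  | zero => simp only [map_zero, LinearMap.zero_apply]
  | add x x' hx hy => simp only [map_add, LinearMap.add_apply, hx, hy]
  | smul r x hx => simp only [map_smul, LinearMap.smul_apply, hx]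
  | cls l =>
    induction y using EHom.induction with
    | zero => simp only [map_zero, LinearMap.zero_apply]
    | add x x' hx hy => simp only [map_add, LinearMap.add_apply, hx, hy]
    | smul r x hx => simp only [map_smul, LinearMap.smul_apply, hx]
    | cls m =>
      induction z using EHom.induction with
      | zero => simp only [map_zero]
      | add x x' hx hy => simp only [map_add, hx, hy]
      | smul r x hx => simp only [map_smul, hx]
      | cls n => simp only [EHom.comp_cls, Category.assoc]

/-- The objects of `E`: pairs of finite sets. -/
structure ECat (k : Type u) where
  pair : FinPair

/-- The `k`-linear category `E`. -/
instance : Category (ECat k) where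
  Hom A B := EHom k A.pair B.pair
  id A := EHom.cls k (𝟙 A.pair)
  comp {A B C} f g := EHom.comp k A.pair B.pair C.pair f g
  id_comp f := EHom.id_comp k f
  comp_id f := EHom.comp_id k f
  assoc f g h := EHom.assoc k f g h

instance : Preadditive (ECat k) where
  homGroup A B := (inferInstance : AddCommGroup (EHom k A.pair B.pair))
  add_comp _ _ _ f f' g := (EHom.comp k _ _ _).map_add₂ f f' g
  comp_add A B C f g g' := (EHom.comp k A.pair B.pair C.pair f).map_add g g'

instance : Linear k (ECat k) where
  homModule A B := inferInstanceAs (Module k (EHom k A.pair B.pair))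
  smul_comp _ _ _ r f g := LinearMap.map_smul₂ (EHom.comp k _ _ _) r f g
  comp_smul A B C f r g := (EHom.comp k A.pair B.pair C.pair f).map_smul r g

/-- The morphism of `E` given by a morphism of `𝔇`. -/
def ECat.ofD {A B : ECat k} (m : A.pair ⟶ B.pair) : A ⟶ B := EHom.cls k m

theorem ECat.ofD_comp {A B C : ECat k} (m : A.pair ⟶ B.pair) (n : B.pair ⟶ C.pair) :
    ECat.ofD k (A := A) (B := C) (m ≫ n) = ECat.ofD k m ≫ ECat.ofD k n :=
  (EHom.comp_cls k m n).symm

/-- The morphisms of `E₀`: the image of the `k`-linearization of `𝔇₀` in the morphisms of `E`. -/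
def E0Hom (A B : ECat k) : Submodule k (A ⟶ B) :=
  Submodule.span k {x | ∃ m : A.pair ⟶ B.pair, IsD0 m ∧ x = ECat.ofD k m}

theorem E0Hom_comp {A B C : ECat k} {f : A ⟶ B} {g : B ⟶ C} (hf : f ∈ E0Hom k A B)
    (hg : g ∈ E0Hom k B C) : f ≫ g ∈ E0Hom k A C := by
  induction hf using Submodule.span_induction with
  | zero => rw [Limits.zero_comp]; exact Submodule.zero_mem _
  | add x y _ _ hx hy => rw [Preadditive.add_comp]; exact Submodule.add_mem _ hx hy
  | smul r x _ hx => rw [Linear.smul_comp]; exact Submodule.smul_mem _ _ hx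
  | mem x h =>
    obtain ⟨m, hm, rfl⟩ := h
    induction hg using Submodule.span_induction with
    | zero => rw [Limits.comp_zero]; exact Submodule.zero_mem _
    | add x y _ _ hx hy => rw [Preadditive.comp_add]; exact Submodule.add_mem _ hx hy
    | smul r x _ hx => rw [Linear.comp_smul]; exact Submodule.smul_mem _ _ hx
    | mem x h =>
      obtain ⟨n, hn, rfl⟩ := h
      exact Submodule.subset_span ⟨m ≫ n, isD0_comp hm hn, (ECat.ofD_comp k m n).symm⟩

/-- The objects of `E₀`: those of `E`. -/
structure E0Cat (k : Type u) where
  obj : ECat k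

/-- The wide subcategory `E₀ ⊂ E`. -/
instance : Category (E0Cat k) where
  Hom A B := E0Hom k A.obj B.obj
  id A := ⟨𝟙 A.obj, Submodule.subset_span ⟨𝟙 A.obj.pair, isD0_id _, rfl⟩⟩
  comp f g := ⟨f.1 ≫ g.1, E0Hom_comp k f.2 g.2⟩
  id_comp f := Subtype.ext (Category.id_comp f.1)
  comp_id f := Subtype.ext (Category.comp_id f.1)
  assoc f g h := Subtype.ext (Category.assoc f.1 g.1 h.1)

instance : Preadditive (E0Cat k) where
  homGroup A B := inferInstanceAs (AddCommGroup (E0Hom k A.obj B.obj))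
  add_comp _ _ _ f f' g := Subtype.ext (Preadditive.add_comp _ _ _ f.1 f'.1 g.1)
  comp_add _ _ _ f g g' := Subtype.ext (Preadditive.comp_add _ _ _ f.1 g.1 g'.1)

instance : Linear k (E0Cat k) where
  homModule A B := inferInstanceAs (Module k (E0Hom k A.obj B.obj))
  smul_comp _ _ _ r f g := Subtype.ext (Linear.smul_comp _ _ _ r f.1 g.1)
  comp_smul _ _ _ f r g := Subtype.ext (Linear.comp_smul _ _ _ f.1 r g.1)

/-- The property of a functor between `k`-linear categories of being `k`-linear. -/
def isLinear (C : Type*) [Category C] [Preadditive C] [Linear k C] :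
    ObjectProperty (C ⥤ ModuleCat.{u} k) :=
  fun F => F.Additive ∧ F.Linear k

/-- The category of `E`-modules: `k`-linear functors from `E` to `k`-modules. -/
abbrev EMod := (isLinear k (ECat k)).FullSubcategory

/-- The category of `E₀`-modules: `k`-linear functors from `E₀` to `k`-modules. -/
abbrev E0Mod := (isLinear k (E0Cat k)).FullSubcategory

instance (F : EMod k) : F.obj.Additive := F.property.1
instance (F : EMod k) : F.obj.Linear k := F.property.2
instance (F : E0Mod k) : F.obj.Additive := F.property.1
instance (F : E0Mod k) : F.obj.Linear k := F.property.2

theorem E0Hom_eq_top {A B : ECat k} (h : A.pair.deg = B.pair.deg) : E0Hom k A B = ⊤ := by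
  rw [eq_top_iff]
  rintro f -
  refine EHom.induction (p := fun f => f ∈ E0Hom k A B) f (fun m => ?_) (Submodule.zero_mem _)
    (fun x y hx hy => Submodule.add_mem _ hx hy) (fun r x hx => Submodule.smul_mem _ _ hx)
  exact Submodule.subset_span ⟨m, (isD0_iff m).2 h, rfl⟩

theorem E0Hom_eq_bot {A B : ECat k} (h : A.pair.deg ≠ B.pair.deg) : E0Hom k A B = ⊥ := by
  rw [eq_bot_iff, E0Hom, Submodule.span_le]
  rintro _ ⟨m, hm, -⟩
  exact (h ((isD0_iff m).1 hm)).elim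

theorem EHom_eq_zero {A B : ECat k} (h : ¬ A.pair.deg ≤ B.pair.deg) (f : A ⟶ B) : f = 0 :=
  EHom.induction (p := fun f => f = (0 : A ⟶ B)) f (fun m => (h (deg_le m)).elim) rfl
    (fun x y hx hy => by rw [hx, hy]; exact add_zero (0 : A ⟶ B))
    (fun r x hx => by rw [hx]; exact smul_zero r)

open Classical in
/-- The action of a morphism of `E` on the extension by zero of an `E₀`-module `M`: morphisms
of `E₀` act as they do on `M`, all other morphisms of `𝔇` act by zero. -/
def extMap (M : E0Mod k) {A B : ECat k} (f : A ⟶ B) :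
    M.obj.obj ⟨A⟩ ⟶ M.obj.obj ⟨B⟩ :=
  if h : f ∈ E0Hom k A B then M.obj.map (X := ⟨A⟩) (Y := ⟨B⟩) ⟨f, h⟩ else 0

theorem extMap_of_mem (M : E0Mod k) {A B : ECat k} {f : A ⟶ B} (h : f ∈ E0Hom k A B) :
    extMap k M f = M.obj.map (X := ⟨A⟩) (Y := ⟨B⟩) ⟨f, h⟩ := dif_pos h

theorem extMap_of_deg_ne (M : E0Mod k) {A B : ECat k} (f : A ⟶ B)
    (h : A.pair.deg ≠ B.pair.deg) : extMap k M f = 0 := by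
  unfold extMap
  split_ifs with hf
  · have h0 : f = 0 := by simpa only [E0Hom_eq_bot k h, Submodule.mem_bot] using hf
    subst h0
    exact M.obj.map_zero ⟨A⟩ ⟨B⟩
  · rfl

theorem extMap_ofD_of_isD0 (M : E0Mod k) {A B : ECat k} {m : A.pair ⟶ B.pair} (h : IsD0 m) :
    extMap k M (ECat.ofD k m) =
      M.obj.map (X := ⟨A⟩) (Y := ⟨B⟩)
        ⟨ECat.ofD k m, Submodule.subset_span ⟨m, h, rfl⟩⟩ :=
  extMap_of_mem _ _ _

theorem extMap_ofD_of_not_isD0 (M : E0Mod k) {A B : ECat k} {m : A.pair ⟶ B.pair}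
    (h : ¬ IsD0 m) : extMap k M (ECat.ofD k m) = 0 :=
  extMap_of_deg_ne _ _ _ fun hd => h ((isD0_iff m).2 hd)

theorem extMap_add (M : E0Mod k) {A B : ECat k} (f g : A ⟶ B) :
    extMap k M (f + g) = extMap k M f + extMap k M g := by
  by_cases h : A.pair.deg = B.pair.deg
  · have ht : ∀ x : A ⟶ B, x ∈ E0Hom k A B := fun x => by rw [E0Hom_eq_top k h]; trivial
    rw [extMap_of_mem k M (ht _), extMap_of_mem k M (ht f), extMap_of_mem k M (ht g),
      ← M.obj.map_add]
    rfl
  · rw [extMap_of_deg_ne k M _ h, extMap_of_deg_ne k M _ h, extMap_of_deg_ne k M _ h, add_zero]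

theorem extMap_smul (M : E0Mod k) {A B : ECat k} (r : k) (f : A ⟶ B) :
    extMap k M (r • f) = r • extMap k M f := by
  by_cases h : A.pair.deg = B.pair.deg
  · have ht : ∀ x : A ⟶ B, x ∈ E0Hom k A B := fun x => by rw [E0Hom_eq_top k h]; trivial
    rw [extMap_of_mem k M (ht _), extMap_of_mem k M (ht f), ← M.obj.map_smul]
    rfl
  · rw [extMap_of_deg_ne k M _ h, extMap_of_deg_ne k M _ h, smul_zero]

theorem extMap_comp (M : E0Mod k) {A B C : ECat k} (f : A ⟶ B) (g : B ⟶ C) :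
    extMap k M (f ≫ g) = extMap k M f ≫ extMap k M g := by
  by_cases h : A.pair.deg = B.pair.deg
  · have hf : f ∈ E0Hom k A B := by rw [E0Hom_eq_top k h]; trivial
    by_cases h' : B.pair.deg = C.pair.deg
    · have hg : g ∈ E0Hom k B C := by rw [E0Hom_eq_top k h']; trivial
      rw [extMap_of_mem k M hf, extMap_of_mem k M hg, extMap_of_mem k M (E0Hom_comp k hf hg),
        ← M.obj.map_comp]
      rfl
    · rw [extMap_of_deg_ne k M g h', extMap_of_deg_ne k M _ (h ▸ h'), Limits.comp_zero]
  · rw [extMap_of_deg_ne k M f h, Limits.zero_comp]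
    by_cases h1 : A.pair.deg ≤ B.pair.deg
    · by_cases h2 : B.pair.deg ≤ C.pair.deg
      · exact extMap_of_deg_ne k M _ (by omega)
      · rw [EHom_eq_zero k h2 g, Limits.comp_zero]
        have h0 := extMap_smul k M (0 : k) (0 : A ⟶ C)
        rwa [zero_smul, zero_smul] at h0
    · rw [EHom_eq_zero k h1 f, Limits.zero_comp]
      have h0 := extMap_smul k M (0 : k) (0 : A ⟶ C)
      rwa [zero_smul, zero_smul] at h0

/-- Extension by zero of an `E₀`-module. -/
def extObj (M : E0Mod k) : EMod k where
  obj :=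
    { obj := fun A => M.obj.obj ⟨A⟩
      map := fun f => extMap k M f
      map_id := fun A => by
        exact (extMap_of_mem k M (𝟙 (E0Cat.mk A) : E0Cat.mk A ⟶ E0Cat.mk A).2).trans
          (M.obj.map_id ⟨A⟩)
      map_comp := fun f g => extMap_comp k M f g }
  property := ⟨⟨fun {_ _ f g} => extMap_add k M f g⟩, ⟨fun f r => extMap_smul k M r f⟩⟩

/-- The extension by zero functor from `E₀`-modules to `E`-modules. -/
def extByZero : E0Mod k ⥤ EMod k where
  obj M := extObj k M
  map {M N} φ := ObjectProperty.homMk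
    { app := fun A => φ.hom.app ⟨A⟩
      naturality := fun A B f => by
        change extMap k M f ≫ _ = _ ≫ extMap k N f
        by_cases h : A.pair.deg = B.pair.deg
        · have hf : f ∈ E0Hom k A B := by rw [E0Hom_eq_top k h]; trivial
          rw [extMap_of_mem k M hf, extMap_of_mem k N hf]
          exact φ.hom.naturality _
        · rw [extMap_of_deg_ne k M f h, extMap_of_deg_ne k N f h, Limits.zero_comp,
            Limits.comp_zero] }
  map_id _ := rfl
  map_comp _ _ := rfl

/-! ## The left adjoint of extension by zero -/

/-- The submodule of `F(A)` generated by the images of the morphisms of `𝔇` that do not belong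
to `𝔇₀`. -/
def hKer (F : EMod k) (A : ECat k) : Submodule k (F.obj.obj A) :=
  Submodule.span k {y | ∃ (B : ECat k) (m : B.pair ⟶ A.pair) (x : F.obj.obj B),
    ¬ IsD0 m ∧ y = F.obj.map (ECat.ofD k m) x}

theorem hKer_le_comap (F : EMod k) {A B : ECat k} {f : A ⟶ B} (hf : f ∈ E0Hom k A B) :
    hKer k F A ≤ (hKer k F B).comap (F.obj.map f).hom := by
  induction hf using Submodule.span_induction with
  | zero =>
    intro x _
    rw [Submodule.mem_comap, F.obj.map_zero]
    exact Submodule.zero_mem _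
  | add f g _ _ hf hg =>
    intro x hx
    rw [Submodule.mem_comap, F.obj.map_add]
    exact Submodule.add_mem _ (hf hx) (hg hx)
  | smul r f _ hf =>
    intro x hx
    rw [Submodule.mem_comap, F.obj.map_smul]
    exact Submodule.smul_mem _ r (hf hx)
  | mem f h =>
    obtain ⟨n, hn, rfl⟩ := h
    rw [hKer, Submodule.span_le]
    rintro _ ⟨C, m, x, hm, rfl⟩
    refine Submodule.subset_span ⟨C, m ≫ n, x, fun h => hm ?_, ?_⟩
    · rw [isD0_iff] at h hn ⊢
      exact h.trans hn.symm
    · rw [ECat.ofD_comp k (A := C) (B := A) (C := B), F.obj.map_comp]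
      rfl

theorem map_mem_hKer (F : EMod k) {A B : ECat k} (f : A ⟶ B) (h : A.pair.deg ≠ B.pair.deg)
    (x : F.obj.obj A) : F.obj.map f x ∈ hKer k F B := by
  refine EHom.induction (p := fun f => F.obj.map (X := A) (Y := B) f x ∈ hKer k F B) f
    (fun m => ?_) ?_ (fun f g hf hg => ?_) (fun r f hf => ?_)
  · exact Submodule.subset_span ⟨A, m, x, fun hm => h ((isD0_iff m).1 hm), rfl⟩
  · have h0 : F.obj.map (0 : A ⟶ B) x = 0 := by rw [F.obj.map_zero]; rfl
    exact h0 ▸ Submodule.zero_mem _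
  · have h0 : F.obj.map (X := A) (Y := B) (f + g) x =
        F.obj.map (X := A) (Y := B) f x + F.obj.map (X := A) (Y := B) g x := by
      exact congrArg (fun t : F.obj.obj A ⟶ F.obj.obj B => t x)
        (F.obj.map_add (X := A) (Y := B) (f := f) (g := g))
    exact h0 ▸ Submodule.add_mem _ hf hg
  · have h0 : F.obj.map (X := A) (Y := B) (r • f) x = r • F.obj.map (X := A) (Y := B) f x := by
      exact congrArg (fun t : F.obj.obj A ⟶ F.obj.obj B => t x)
        (F.obj.map_smul (X := A) (Y := B) r f)
    exact h0 ▸ Submodule.smul_mem _ r hf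

/-- The value on objects of the left adjoint of extension by zero. -/
def hObj (F : EMod k) : E0Mod k where
  obj :=
    { obj := fun A => ModuleCat.of k (F.obj.obj A.obj ⧸ hKer k F A.obj)
      map := fun f => ModuleCat.ofHom (Submodule.mapQ _ _ (F.obj.map f.1).hom
        (hKer_le_comap k F f.2))
      map_id := fun A => by
        ext x
        exact congrArg (fun t : F.obj.obj A.obj ⟶ F.obj.obj A.obj =>
          (hKer k F A.obj).mkQ (t x)) (F.obj.map_id A.obj)
      map_comp := fun {A B C} f g => by
        ext x
        exact congrArg (fun t : F.obj.obj A.obj ⟶ F.obj.obj C.obj =>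
          (hKer k F C.obj).mkQ (t x)) (F.obj.map_comp f.1 g.1) }
  property := ⟨⟨fun {A B f g} => by
      ext x
      exact congrArg (fun t : F.obj.obj A.obj ⟶ F.obj.obj B.obj =>
        (hKer k F B.obj).mkQ (t x)) (F.obj.map_add (f := f.1) (g := g.1))⟩,
    ⟨fun {A B} f r => by
      ext x
      exact congrArg (fun t : F.obj.obj A.obj ⟶ F.obj.obj B.obj =>
        (hKer k F B.obj).mkQ (t x)) (F.obj.map_smul r f.1)⟩⟩

/-- The value on morphisms of the left adjoint of extension by zero. -/
def hMap {F G : EMod k} (φ : F ⟶ G) : hObj k F ⟶ hObj k G :=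
  ObjectProperty.homMk
    { app := fun A => ModuleCat.ofHom (Submodule.mapQ _ _ (φ.hom.app A.obj).hom (by
        rw [hKer, Submodule.span_le]
        rintro _ ⟨C, m, x, hm, rfl⟩
        refine Submodule.subset_span ⟨C, m, φ.hom.app C x, hm, ?_⟩
        exact congrArg (fun t : F.obj.obj C ⟶ G.obj.obj A.obj => t x)
          (φ.hom.naturality (ECat.ofD k m))))
      naturality := fun A B f => by
        refine ModuleCat.hom_ext (Submodule.linearMap_qext _ (LinearMap.ext fun x => ?_))
        exact congrArg (fun t : F.obj.obj A.obj ⟶ G.obj.obj B.obj =>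
          (hKer k G B.obj).mkQ (t x)) (φ.hom.naturality f.1) }

theorem hMap_app_mk {F G : EMod k} (φ : F ⟶ G) (A : E0Cat k) (x : F.obj.obj A.obj) :
    ((hMap k φ).hom.app A).hom ((hKer k F A.obj).mkQ x) =
      (hKer k G A.obj).mkQ ((φ.hom.app A.obj).hom x) := rfl

theorem hObj_hom_ext {F : EMod k} {M : E0Mod k} {α β : hObj k F ⟶ M}
    (h : ∀ (A : E0Cat k) (x : F.obj.obj A.obj),
      (α.hom.app A).hom ((hKer k F A.obj).mkQ x) = (β.hom.app A).hom ((hKer k F A.obj).mkQ x)) :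
    α = β := by
  ext A x
  obtain ⟨x, rfl⟩ := (hKer k F A.obj).mkQ_surjective x
  exact h A x

/-- The functor `H` from `E`-modules to `E₀`-modules, sending `F` to its largest quotient on which
the morphisms of `𝔇` not belonging to `𝔇₀` act by zero. It is left adjoint to extension by zero,
see `hAdjunction`. -/
def hFunctor : EMod k ⥤ E0Mod k where
  obj F := hObj k F
  map φ := hMap k φ
  map_id F := hObj_hom_ext k fun A x => by
    rw [hMap_app_mk]
    rfl
  map_comp {F G L} φ ψ := hObj_hom_ext k fun A x =>
    (hMap_app_mk k (φ ≫ ψ) A x).trans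
      ((hMap_app_mk k ψ A ((φ.hom.app A.obj).hom x)).symm.trans
        (congrArg ((hMap k ψ).hom.app A).hom (hMap_app_mk k φ A x).symm))

/-- The morphism `F ⟶ ext M` corresponding to a morphism `H F ⟶ M`. -/
def adjTo {F : EMod k} {M : E0Mod k} (α : hObj k F ⟶ M) : F ⟶ extObj k M :=
  ObjectProperty.homMk
    { app := fun A => ModuleCat.ofHom ((α.hom.app ⟨A⟩).hom ∘ₗ (hKer k F A).mkQ)
      naturality := fun A B f => by
        change _ = _ ≫ extMap k M f
        by_cases h : A.pair.deg = B.pair.deg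
        · have hf : f ∈ E0Hom k A B := by rw [E0Hom_eq_top k h]; trivial
          rw [extMap_of_mem k M hf]
          refine ModuleCat.hom_ext (LinearMap.ext fun x => ?_)
          exact congrArg (fun t : (hObj k F).obj.obj ⟨A⟩ ⟶ M.obj.obj ⟨B⟩ =>
            t ((hKer k F A).mkQ x)) (α.hom.naturality (X := ⟨A⟩) (Y := ⟨B⟩) ⟨f, hf⟩)
        · rw [extMap_of_deg_ne k M f h, Limits.comp_zero]
          refine ModuleCat.hom_ext (LinearMap.ext fun x => ?_)
          have h0 : (hKer k F B).mkQ (F.obj.map f x) = 0 :=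
            (Submodule.Quotient.mk_eq_zero _).2 (map_mem_hKer k F f h x)
          exact (congrArg (α.hom.app ⟨B⟩).hom h0).trans (map_zero _) }

/-- The morphism `H F ⟶ M` corresponding to a morphism `F ⟶ ext M`. -/
def adjInv {F : EMod k} {M : E0Mod k} (β : F ⟶ extObj k M) : hObj k F ⟶ M :=
  ObjectProperty.homMk
    { app := fun A => ModuleCat.ofHom
        ((hKer k F A.obj).liftQ (β.hom.app A.obj).hom (by
          rw [hKer, Submodule.span_le]
          rintro _ ⟨C, m, x, hm, rfl⟩
          have h1 := congrArg (fun t : F.obj.obj C ⟶ M.obj.obj A => t x)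
            (β.hom.naturality (ECat.ofD k m))
          refine h1.trans ?_
          exact congrArg (fun t : M.obj.obj ⟨C⟩ ⟶ M.obj.obj A => t (β.hom.app C x))
            (extMap_ofD_of_not_isD0 k M (A := C) (B := A.obj) hm)))
      naturality := fun A B f => by
        refine ModuleCat.hom_ext (Submodule.linearMap_qext _ (LinearMap.ext fun x => ?_))
        have h1 := congrArg (fun t : F.obj.obj A.obj ⟶ M.obj.obj B => t x)
          (β.hom.naturality f.1)
        refine h1.trans ?_
        exact congrArg (fun t : M.obj.obj A ⟶ M.obj.obj B => t (β.hom.app A.obj x))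
          (extMap_of_mem k M f.2) }

theorem adjInv_app_mk {F : EMod k} {M : E0Mod k} (β : F ⟶ extObj k M) (A : E0Cat k)
    (x : F.obj.obj A.obj) :
    ((adjInv k β).hom.app A).hom ((hKer k F A.obj).mkQ x) = (β.hom.app A.obj).hom x := rfl

theorem adjTo_app {F : EMod k} {M : E0Mod k} (α : hObj k F ⟶ M) (A : ECat k)
    (x : F.obj.obj A) :
    ((adjTo k α).hom.app A).hom x = (α.hom.app ⟨A⟩).hom ((hKer k F A).mkQ x) := rfl

/-- The functor `H` is left adjoint to extension by zero. -/
def hAdjunction : hFunctor k ⊣ extByZero k :=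
  Adjunction.mkOfHomEquiv
    { homEquiv := fun F M =>
        { toFun := fun α => adjTo k α
          invFun := fun β => adjInv k β
          left_inv := fun α => hObj_hom_ext k fun A x =>
            (adjInv_app_mk k (adjTo k α) A x).trans (adjTo_app k α A.obj x)
          right_inv := fun β => by
            refine ObjectProperty.hom_ext _ (NatTrans.ext (funext fun A =>
              ModuleCat.hom_ext (LinearMap.ext fun x => ?_)))
            exact (adjTo_app k (adjInv k β) A x).trans (adjInv_app_mk k β ⟨A⟩ x) }
      homEquiv_naturality_left_symm := fun {F G M} f g => hObj_hom_ext k fun A x =>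
        (adjInv_app_mk k (f ≫ g) A x).trans
          ((adjInv_app_mk k g A ((f.hom.app A.obj).hom x)).symm.trans
            (congrArg ((adjInv k g).hom.app A).hom (hMap_app_mk k f A x).symm))
      homEquiv_naturality_right := fun _ _ => rfl }

/-! ## Baby beads -/

/-- Arrangements of the beads `X` into columns labelled by `Y`, each column containing one or two
beads: the bead `x` is placed in the column `(pos x).1`, in the bottom row if `(pos x).2 = 0` and in
the top row if `(pos x).2 = 1`; there is at most one bead in each place, and the bottom place of
each column is occupied. -/
@[ext] structure Beads (A : FinPair) where
  pos : A.X ↪ A.Y × Fin 2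
  bottom : ∀ y, ∃ x, pos x = (y, 0)

instance (A : FinPair) : Finite (Beads A) :=
  Finite.of_injective (fun φ : Beads A => (φ.pos : A.X → A.Y × Fin 2)) fun _ _ h =>
    Beads.ext (DFunLike.coe_injective h)

instance (A : FinPair) : Fintype (Beads A) := Fintype.ofFinite _

/-- Relabelling the beads by a permutation: the bead `σ x` is placed where `x` was. -/
def Beads.relabel {A : FinPair} (σ : Equiv.Perm A.X) (φ : Beads A) : Beads A where
  pos := σ.symm.toEmbedding.trans φ.pos
  bottom y := by
    obtain ⟨x, hx⟩ := φ.bottom y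
    exact ⟨σ x, by simpa using hx⟩

theorem Beads.relabel_pos {A : FinPair} (σ : Equiv.Perm A.X) (φ : Beads A) (x : A.X) :
    (φ.relabel σ).pos x = φ.pos (σ.symm x) := rfl

/-- The arrangement `ψ` of `(U, V)` extends the arrangement `φ` of `(X, Y)` along a morphism
`(i, j, ζ)` of `𝔇`: the beads of `φ` keep their places, and each column `v` not in the image of `j`
has bottom bead `ζ (1, v)` and top bead `ζ (2, v)`. (The remaining beads, those in neither the
image of `i` nor that of `ζ`, are then necessarily in the top row of columns
of `φ` having a single bead.) -/
def Extends {A B : FinPair} (m : A ⟶ B) (φ : Beads A) (ψ : Beads B) : Prop :=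
  (∀ x, ψ.pos (m.i x) = (m.j (φ.pos x).1, (φ.pos x).2)) ∧
    ∀ p, ψ.pos (m.ζ p) = (p.2.1, p.1)

theorem extends_id {A : FinPair} (φ ψ : Beads A) : Extends (𝟙 A) φ ψ ↔ ψ = φ := by
  constructor
  · intro h
    ext1
    ext1 x
    exact h.1 x
  · rintro rfl
    exact ⟨fun _ => rfl, fun p => (p.2.2 ⟨p.2.1, rfl⟩).elim⟩

theorem Extends.unique {A B : FinPair} {m : A ⟶ B} {φ φ' : Beads A} {ψ : Beads B}
    (h : Extends m φ ψ) (h' : Extends m φ' ψ) : φ = φ' := by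
  ext1
  ext1 x
  have h1 := (h.1 x).symm.trans (h'.1 x)
  rw [Prod.mk.injEq] at h1
  exact Prod.ext (m.j.injective h1.1) h1.2

theorem Extends.comp {A B C : FinPair} {m : A ⟶ B} {n : B ⟶ C} {φ : Beads A} {ψ : Beads B}
    {χ : Beads C} (h : Extends m φ ψ) (h' : Extends n ψ χ) : Extends (m ≫ n) φ χ := by
  refine ⟨fun x => ?_, ?_⟩
  · change χ.pos (n.i (m.i x)) = _
    rw [h'.1, h.1]
    rfl
  · rintro ⟨ε, z, hz⟩
    by_cases hm : z ∈ Set.range n.j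
    · obtain ⟨v, rfl⟩ := hm
      have hv : v ∉ Set.range m.j := by
        rintro ⟨y, rfl⟩; exact hz ⟨y, rfl⟩
      have h1 := DHom.comp_ζ_of_mem m n ε v hv hz
      refine (congrArg χ.pos h1).trans ?_
      rw [h'.1, h.2]
    · have h1 := DHom.comp_ζ_of_not_mem m n ε z hm hz
      refine (congrArg χ.pos h1).trans ?_
      rw [h'.2]

theorem Extends.exists_of_comp {A B C : FinPair} {m : A ⟶ B} {n : B ⟶ C} {φ : Beads A}
    {χ : Beads C} (h : Extends (m ≫ n) φ χ) : ∃ ψ, Extends m φ ψ ∧ Extends n ψ χ := by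
  have hn : ∀ (ε : Fin 2) (z : C.Y) (hz : z ∉ Set.range n.j),
      χ.pos (n.ζ (ε, ⟨z, hz⟩)) = (z, ε) := by
    intro ε z hz
    have hz' : z ∉ Set.range (DHom.comp m n).j := by
      rintro ⟨y, rfl⟩; exact hz ⟨_, rfl⟩
    have h1 := DHom.comp_ζ_of_not_mem m n ε z hz hz'
    exact (congrArg χ.pos h1).symm.trans (h.2 (ε, ⟨z, hz'⟩))
  have hmem : ∀ u, ∃ p : B.Y × Fin 2, χ.pos (n.i u) = (n.j p.1, p.2) := by
    intro u
    by_cases hz : (χ.pos (n.i u)).1 ∈ Set.range n.j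
    · obtain ⟨v, hv⟩ := hz
      exact ⟨(v, (χ.pos (n.i u)).2), Prod.ext hv.symm rfl⟩
    · have h1 := hn (χ.pos (n.i u)).2 _ hz
      exact ((n.ζ _).2 ⟨u, (χ.pos.injective h1).symm⟩).elim
  choose p hp using hmem
  have hinj : Function.Injective p := fun u u' huu => by
    have h1 : χ.pos (n.i u) = χ.pos (n.i u') := by rw [hp, hp, huu]
    exact n.i.injective (χ.pos.injective h1)
  have hext1 : ∀ x, p (m.i x) = (m.j (φ.pos x).1, (φ.pos x).2) := by
    intro x
    have h1 := (hp (m.i x)).symm.trans (h.1 x)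
    rw [Prod.mk.injEq] at h1
    exact Prod.ext (n.j.injective h1.1) h1.2
  have hext2 : ∀ q, p (m.ζ q) = (q.2.1, q.1) := by
    rintro ⟨ε, v, hv⟩
    have hz : n.j v ∉ Set.range (DHom.comp m n).j := by
      rintro ⟨y, hy⟩; exact hv ⟨y, n.j.injective hy⟩
    have h1 := DHom.comp_ζ_of_mem m n ε v hv hz
    have h2 := (congrArg χ.pos h1).symm.trans (h.2 (ε, ⟨n.j v, hz⟩))
    have h3 := (hp _).symm.trans h2
    rw [Prod.mk.injEq] at h3
    exact Prod.ext (n.j.injective h3.1) h3.2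
  refine ⟨⟨⟨p, hinj⟩, fun v => ?_⟩, ⟨hext1, hext2⟩, ⟨hp, fun q => hn _ _ _⟩⟩
  by_cases hv : v ∈ Set.range m.j
  · obtain ⟨y, rfl⟩ := hv
    obtain ⟨x, hx⟩ := φ.bottom y
    refine ⟨m.i x, ?_⟩
    have h1 := hext1 x
    rw [hx] at h1
    exact h1
  · exact ⟨m.ζ (0, ⟨v, hv⟩), hext2 _⟩

open Classical in
/-- The action of a morphism of `𝔇` on the linearization of `Beads`: an arrangement is sent to the
sum of all arrangements that extend it. -/
def beadsMap {A B : FinPair} (m : A ⟶ B) : (Beads A →₀ k) →ₗ[k] (Beads B →₀ k) :=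
  Finsupp.linearCombination k fun φ => ∑ ψ with Extends m φ ψ, Finsupp.single ψ 1

open Classical in
theorem beadsMap_single {A B : FinPair} (m : A ⟶ B) (φ : Beads A) :
    beadsMap k m (Finsupp.single φ 1) = ∑ ψ with Extends m φ ψ, Finsupp.single ψ 1 := by
  rw [beadsMap, Finsupp.linearCombination_single, one_smul]

theorem beads_hom_ext {A : FinPair} {M : Type*} [AddCommGroup M] [Module k M]
    {f g : (Beads A →₀ k) →ₗ[k] M}
    (h : ∀ φ, f (Finsupp.single φ 1) = g (Finsupp.single φ 1)) : f = g :=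
  Finsupp.lhom_ext' fun φ => LinearMap.ext_ring (h φ)

theorem beadsMap_id (A : FinPair) : beadsMap k (𝟙 A) = LinearMap.id := by
  classical
  refine beads_hom_ext k fun φ => ?_
  rw [beadsMap_single, LinearMap.id_apply]
  refine (Finset.sum_congr ?_ fun _ _ => rfl).trans
    (Finset.sum_singleton (fun ψ : Beads A => (Finsupp.single ψ 1 : Beads A →₀ k)) φ)
  ext ψ
  simp only [Finset.mem_filter, Finset.mem_univ, true_and, Finset.mem_singleton, extends_id]

theorem beadsMap_comp {A B C : FinPair} (m : A ⟶ B) (n : B ⟶ C) :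
    beadsMap k (m ≫ n) = beadsMap k n ∘ₗ beadsMap k m := by
  classical
  refine beads_hom_ext k fun φ => ?_
  rw [LinearMap.comp_apply, beadsMap_single, beadsMap_single, map_sum]
  simp only [beadsMap_single]
  rw [← Finset.sum_biUnion]
  · refine Finset.sum_congr ?_ fun _ _ => rfl
    ext χ
    simp only [Finset.mem_filter, Finset.mem_univ, true_and, Finset.mem_biUnion]
    exact ⟨fun h => h.exists_of_comp, fun ⟨ψ, h, h'⟩ => h.comp h'⟩
  · intro ψ _ ψ' _ hne
    refine Finset.disjoint_left.2 fun χ h h' => hne ?_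
    simp only [Finset.mem_filter, Finset.mem_univ, true_and] at h h'
    exact h.unique h'

/-- The `𝔇`-module given by the linearization of `Beads`. -/
def beadsFunctor : FinPair ⥤ ModuleCat.{u} k where
  obj A := ModuleCat.of k (Beads A →₀ k)
  map m := ModuleCat.ofHom (beadsMap k m)
  map_id A := by rw [beadsMap_id]; rfl
  map_comp m n := by rw [beadsMap_comp]; rfl

open Classical in
/-- The anticommutativity relations `φ + τ φ`, for an arrangement `φ` and the transposition `τ`
of the labels of the two beads of a column of `φ`. -/
def beadsRel (A : FinPair) : Submodule k (Beads A →₀ k) :=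
  Submodule.span k {x | ∃ (φ : Beads A) (a b : A.X), a ≠ b ∧ (φ.pos a).1 = (φ.pos b).1 ∧
    x = Finsupp.single φ 1 + Finsupp.single (φ.relabel (Equiv.swap a b)) 1}

open Classical in
theorem beadsMap_add_mem {A A' B : FinPair} (m : A ⟶ B) (m' : A' ⟶ B) (φ : Beads A)
    (φ' : Beads A') (a b : B.X) (hab : a ≠ b)
    (hcol : ∀ ψ, Extends m φ ψ → (ψ.pos a).1 = (ψ.pos b).1)
    (h : ∀ ψ, Extends m φ ψ ↔ Extends m' φ' (ψ.relabel (Equiv.swap a b))) :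
    beadsMap k m (Finsupp.single φ 1) + beadsMap k m' (Finsupp.single φ' 1) ∈ beadsRel k B := by
  have hinv : ∀ ψ : Beads B, (ψ.relabel (Equiv.swap a b)).relabel (Equiv.swap a b) = ψ := by
    intro ψ
    ext1
    ext1 x
    simp only [Beads.relabel_pos, Equiv.symm_swap, Equiv.swap_apply_self]
  have hsum : beadsMap k m' (Finsupp.single φ' 1) =
      ∑ ψ with Extends m φ ψ, Finsupp.single (ψ.relabel (Equiv.swap a b)) 1 := by
    rw [beadsMap_single]
    refine Finset.sum_bij' (fun ψ _ => ψ.relabel (Equiv.swap a b))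
      (fun ψ _ => ψ.relabel (Equiv.swap a b)) ?_ ?_ ?_ ?_ ?_
    · intro ψ hψ
      simp only [Finset.mem_filter, Finset.mem_univ, true_and] at hψ ⊢
      rw [h, hinv]
      exact hψ
    · intro ψ hψ
      simp only [Finset.mem_filter, Finset.mem_univ, true_and] at hψ ⊢
      exact (h ψ).1 hψ
    · exact fun ψ _ => hinv ψ
    · exact fun ψ _ => hinv ψ
    · intro ψ _
      rw [hinv]
  rw [hsum, beadsMap_single, ← Finset.sum_add_distrib]
  refine Submodule.sum_mem _ fun ψ hψ => Submodule.subset_span ⟨ψ, a, b, hab, hcol ψ ?_, rfl⟩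
  simpa only [Finset.mem_filter, Finset.mem_univ, true_and] using hψ

theorem beadsRel_le_comap {A B : FinPair} (m : A ⟶ B) :
    beadsRel k A ≤ (beadsRel k B).comap (beadsMap k m) := by
  classical
  rw [beadsRel, Submodule.span_le]
  rintro _ ⟨φ, a, b, hab, hcol, rfl⟩
  change beadsMap k m _ ∈ beadsRel k B
  rw [map_add]
  have hs : ∀ x, Equiv.swap (m.i a) (m.i b) (m.i x) = m.i (Equiv.swap a b x) := fun x => by
    rw [← m.i.injective.swap_apply]
  have hζ : ∀ p, Equiv.swap (m.i a) (m.i b) (m.ζ p) = m.ζ p := fun p =>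
    Equiv.swap_apply_of_ne_of_ne (fun h => (m.ζ p).2 ⟨a, h.symm⟩) (fun h => (m.ζ p).2 ⟨b, h.symm⟩)
  refine beadsMap_add_mem k m m φ _ (m.i a) (m.i b) (fun h => hab (m.i.injective h)) ?_ ?_
  · intro ψ h
    rw [h.1, h.1, hcol]
  · intro ψ
    unfold Extends
    simp only [Beads.relabel_pos, Equiv.symm_swap, hs, hζ]
    refine and_congr ⟨fun h x => h _, fun h x => ?_⟩ Iff.rfl
    have h1 := h (Equiv.swap a b x)
    simpa only [Equiv.swap_apply_self] using h1

theorem beadsMap_iota_add_tau (P : FinPair) (x : Beads P →₀ k) :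
    beadsMap k (iotaHom P) x + beadsMap k (tauHom P) x ∈ beadsRel k P.addColumn := by
  classical
  induction x using Finsupp.induction_linear with
  | zero => rw [map_zero, map_zero, add_zero]; exact Submodule.zero_mem _
  | add x y hx hy =>
    rw [map_add, map_add, add_add_add_comm]
    exact Submodule.add_mem _ hx hy
  | single φ r =>
    rw [← mul_one r, ← smul_eq_mul, ← Finsupp.smul_single, map_smul, map_smul, ← smul_add]
    refine Submodule.smul_mem _ _ ?_
    have h0 : ∀ v : {v : P.addColumn.Y // v ∉ Set.range (Sum.inl : P.Y → P.Y ⊕ Unit)},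
        v.1 = Sum.inr () := by
      rintro ⟨v | v, hv⟩
      · exact (hv ⟨v, rfl⟩).elim
      · rfl
    have hE : ∀ (s : Equiv.Perm (Fin 2)) (ψ : Beads P.addColumn),
        Extends (addColumnHom P s) φ ψ ↔
          (∀ x, ψ.pos (Sum.inl x) = (Sum.inl (φ.pos x).1, (φ.pos x).2)) ∧
            ∀ ε, ψ.pos (Sum.inr (s ε)) = (Sum.inr (), ε) := by
      intro s ψ
      refine and_congr Iff.rfl ⟨fun h ε => h (ε, ⟨Sum.inr (), by rintro ⟨y, hy⟩; cases hy⟩),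
        fun h p => ?_⟩
      refine (h p.1).trans ?_
      rw [h0 p.2]
      rfl
    refine beadsMap_add_mem k _ _ φ φ (Sum.inr 0) (Sum.inr 1) ?_ ?_ ?_
    · intro h
      exact absurd (Sum.inr_injective h) (by decide)
    · intro ψ h
      rw [iotaHom, hE] at h
      have h1 := h.2 0
      have h2 := h.2 1
      rw [Equiv.Perm.one_apply] at h1 h2
      rw [h1, h2]
    · intro ψ
      rw [iotaHom, tauHom, hE, hE]
      have hs : ∀ (_ : DecidableEq (P.X ⊕ Fin 2)) (ε : Fin 2),
          Equiv.swap (Sum.inr 0 : P.X ⊕ Fin 2) (Sum.inr 1) (Sum.inr (Equiv.swap 0 1 ε)) =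
            Sum.inr ε := fun _ ε =>
        (Sum.inr_injective.swap_apply 0 1 (Equiv.swap 0 1 ε)).trans
          (congrArg Sum.inr (Equiv.swap_apply_self 0 1 ε))
      have hl : ∀ (_ : DecidableEq (P.X ⊕ Fin 2)) (x : P.X),
          Equiv.swap (Sum.inr 0 : P.X ⊕ Fin 2) (Sum.inr 1) (Sum.inl x) = Sum.inl x := fun _ x =>
        Equiv.swap_apply_of_ne_of_ne (fun h => by cases h) (fun h => by cases h)
      have h1 : ∀ x : P.X, (ψ.relabel (@Equiv.swap P.addColumn.X (fun a b => Classical.propDecidable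
          (a = b)) (Sum.inr 0) (Sum.inr 1))).pos (Sum.inl x) = ψ.pos (Sum.inl x) := fun x =>
        congrArg ψ.pos (hl (fun a b => Classical.propDecidable (a = b)) x)
      have h2 : ∀ ε : Fin 2, (ψ.relabel (@Equiv.swap P.addColumn.X (fun a b => Classical.propDecidable
          (a = b)) (Sum.inr 0) (Sum.inr 1))).pos (Sum.inr (Equiv.swap 0 1 ε)) =
            ψ.pos (Sum.inr ε) := fun ε =>
        congrArg ψ.pos (hs (fun a b => Classical.propDecidable (a = b)) ε)
      exact and_congr (forall_congr' fun x => Eq.congr_left (h1 x).symm)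
        (forall_congr' fun ε => Eq.congr_left (h2 ε).symm)

/-- The value on objects of `Beads^±`. -/
abbrev BeadsPM (A : FinPair) : Type u := (Beads A →₀ k) ⧸ beadsRel k A

/-- The action of the morphisms of `E` on `Beads^±`, induced by the action of `𝔇` on the
linearization of `Beads`. -/
def beadsPMMap (A B : FinPair) : EHom k A B →ₗ[k] BeadsPM k A →ₗ[k] BeadsPM k B :=
  EHom.lift (fun m => Submodule.mapQ _ _ (beadsMap k m) (beadsRel_le_comap k m)) fun P p q => by
    refine Submodule.linearMap_qext _ (LinearMap.ext fun x => ?_)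
    refine (Submodule.Quotient.mk_eq_zero _).2 ?_
    rw [beadsMap_comp, beadsMap_comp, beadsMap_comp, beadsMap_comp]
    simp only [LinearMap.comp_apply]
    rw [← map_add]
    exact beadsRel_le_comap k q (beadsMap_iota_add_tau k P _)

theorem beadsPMMap_cls_mk {A B : FinPair} (m : A ⟶ B) (x : Beads A →₀ k) :
    beadsPMMap k A B (EHom.cls k m) ((beadsRel k A).mkQ x) =
      (beadsRel k B).mkQ (beadsMap k m x) := by
  unfold beadsPMMap
  rw [EHom.lift_cls]
  rfl

theorem beadsPMMap_comp {A B C : FinPair} (f : EHom k A B) (g : EHom k B C) :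
    beadsPMMap k A C (EHom.comp k A B C f g) = beadsPMMap k B C g ∘ₗ beadsPMMap k A B f := by
  induction f using EHom.induction with
  | zero => simp only [map_zero, LinearMap.zero_apply, LinearMap.comp_zero]
  | add x x' hx hy => simp only [map_add, LinearMap.add_apply, hx, hy, LinearMap.comp_add]
  | smul r x hx => simp only [map_smul, LinearMap.smul_apply, hx, LinearMap.comp_smul]
  | cls m =>
    induction g using EHom.induction with
    | zero => simp only [map_zero, LinearMap.zero_comp]
    | add x x' hx hy => simp only [map_add, hx, hy, LinearMap.add_comp]
    | smul r x hx => simp only [map_smul, hx, LinearMap.smul_comp]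
    | cls n =>
      refine Submodule.linearMap_qext _ (LinearMap.ext fun x => ?_)
      rw [EHom.comp_cls]
      simp only [LinearMap.comp_apply]
      rw [beadsPMMap_cls_mk, beadsPMMap_cls_mk, beadsPMMap_cls_mk, beadsMap_comp,
        LinearMap.comp_apply]

theorem beadsPMMap_id (A : FinPair) :
    beadsPMMap k A A (EHom.cls k (𝟙 A)) = LinearMap.id := by
  refine Submodule.linearMap_qext _ (LinearMap.ext fun x => ?_)
  simp only [LinearMap.comp_apply]
  rw [beadsPMMap_cls_mk, beadsMap_id]
  rfl

/-- The `E`-module `Beads^±`. -/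
def beadsPM : EMod k where
  obj :=
    { obj := fun A => ModuleCat.of k (BeadsPM k A.pair)
      map := fun {A B} f => ModuleCat.ofHom (beadsPMMap k A.pair B.pair f)
      map_id := fun A => congrArg ModuleCat.ofHom (beadsPMMap_id k A.pair)
      map_comp := fun f g => congrArg ModuleCat.ofHom (beadsPMMap_comp k f g) }
  property :=
    ⟨⟨fun {A B f g} => congrArg ModuleCat.ofHom ((beadsPMMap k A.pair B.pair).map_add f g)⟩,
      ⟨fun {A B} f r => congrArg ModuleCat.ofHom ((beadsPMMap k A.pair B.pair).map_smul r f)⟩⟩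

/-! ## Schur functors -/

/-- The pair `({1, …, n}, {1, …, b})` as an object of `E₀`. -/
def stdPair (n b : ℕ) : E0Cat k := ⟨⟨⟨Fin n, Fin b⟩⟩⟩

/-- The automorphism of `({1, …, n}, {1, …, b})` given by a pair of permutations. -/
def stdAut (n b : ℕ) (s : Equiv.Perm (Fin n) × Equiv.Perm (Fin b)) :
    stdPair k n b ⟶ stdPair k n b :=
  ⟨ECat.ofD k (isoHom s.1 s.2), Submodule.subset_span ⟨_, isD0_isoHom _ _, rfl⟩⟩

theorem stdAut_one (n b : ℕ) : stdAut k n b 1 = 𝟙 (stdPair k n b) :=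
  Subtype.ext (congrArg (EHom.cls k) (isoHom_refl ⟨Fin n, Fin b⟩))

theorem stdAut_mul (n b : ℕ) (s t : Equiv.Perm (Fin n) × Equiv.Perm (Fin b)) :
    stdAut k n b (s * t) = stdAut k n b t ≫ stdAut k n b s := by
  refine Subtype.ext (Eq.trans ?_ (EHom.comp_cls k _ _).symm)
  exact congrArg (EHom.cls k) (isoHom_comp (A := ⟨Fin n, Fin b⟩) (B := ⟨Fin n, Fin b⟩)
    (C := ⟨Fin n, Fin b⟩) t.1 t.2 s.1 s.2).symm

/-- The action of `𝔖_n × 𝔖_b` on the value `M(n, b)` of an `E₀`-module. -/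
def stdRep (M : E0Mod k) (n b : ℕ) :
    Representation k (Equiv.Perm (Fin n) × Equiv.Perm (Fin b)) (M.obj.obj (stdPair k n b)) where
  toFun s := (M.obj.map (stdAut k n b s)).hom
  map_one' := by rw [stdAut_one, M.obj.map_id]; rfl
  map_mul' s t := by rw [stdAut_mul, M.obj.map_comp]; rfl

variable {k} in
/-- The action of permutations of `ι` on `M^{⊗ι}` by place permutations. -/
def placeRep (ι M : Type*) [AddCommGroup M] [Module k M] :
    Representation k (Equiv.Perm ι) (⨂[k] _ : ι, M) where
  toFun σ := (PiTensorProduct.reindex k (fun _ : ι => M) σ).toLinearMap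
  map_one' := by
    refine LinearMap.ext fun x => ?_
    exact LinearEquiv.congr_fun (PiTensorProduct.reindex_refl (R := k) (s := fun _ : ι => M)) x
  map_mul' σ τ := by
    refine LinearMap.ext fun x => ?_
    exact (PiTensorProduct.reindex_reindex (R := k) (s := fun _ : ι => M) τ σ x).symm

theorem placeRep_map {ι : Type*} {M N : Type*} [AddCommGroup M] [Module k M] [AddCommGroup N]
    [Module k N] (f : M →ₗ[k] N) (σ : Equiv.Perm ι) (x : ⨂[k] _ : ι, M) :
    placeRep (k := k) ι N σ (PiTensorProduct.map (fun _ => f) x) =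
      PiTensorProduct.map (fun _ => f) (placeRep (k := k) ι M σ x) :=
  (PiTensorProduct.map_reindex (fun _ : ι => f) σ x).symm

/-- The diagonal action of `𝔖_n` on `V^{⊗n} ⊗ M(n, b)`. -/
def schurRep (M : E0Mod k) (n b : ℕ) (V : Type u) [AddCommGroup V] [Module k V] :
    Representation k (Equiv.Perm (Fin n))
      ((⨂[k] _ : Fin n, V) ⊗[k] M.obj.obj (stdPair k n b)) :=
  (placeRep (Fin n) V).tprod ((stdRep k M n b).comp (MonoidHom.inl _ _))

/-- The degree `n` part `V^{⊗n} ⊗_{𝔖_n} M(n, b)` of the Schur functor. -/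
abbrev SchurDeg (M : E0Mod k) (n b : ℕ) (V : Type u) [AddCommGroup V] [Module k V] : Type u :=
  (schurRep k M n b V).Coinvariants

/-- The map `V^{⊗n} ⊗_{𝔖_n} M(n, b) → W^{⊗n} ⊗_{𝔖_n} M(n, b)` given by a linear map `f : V → W`
and a permutation `π` of `{1, …, b}`. -/
def schurDegMap (M : E0Mod k) (n b : ℕ) {V W : Type u} [AddCommGroup V] [Module k V]
    [AddCommGroup W] [Module k W] (f : V →ₗ[k] W) (π : Equiv.Perm (Fin b)) :
    SchurDeg k M n b V →ₗ[k] SchurDeg k M n b W :=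
  Representation.Coinvariants.map _ _
    { toLinearMap := TensorProduct.map (PiTensorProduct.map fun _ => f) (stdRep k M n b (1, π))
      isIntertwining' := fun σ => by
        refine TensorProduct.ext' fun x y => ?_
        change _ ⊗ₜ[k] _ = _ ⊗ₜ[k] _
        congr 1
        · exact (placeRep_map k f σ x).symm
        · change (stdRep k M n b (1, π) * stdRep k M n b (σ, 1)) y =
            (stdRep k M n b (σ, 1) * stdRep k M n b (1, π)) y
          rw [← map_mul, ← map_mul, Prod.mk_mul_mk, Prod.mk_mul_mk, mul_one, one_mul, one_mul,
            mul_one] }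

theorem schurDegMap_mk (M : E0Mod k) (n b : ℕ) {V W : Type u} [AddCommGroup V] [Module k V]
    [AddCommGroup W] [Module k W] (f : V →ₗ[k] W) (π : Equiv.Perm (Fin b))
    (x : ⨂[k] _ : Fin n, V) (y : M.obj.obj (stdPair k n b)) :
    schurDegMap k M n b f π (Representation.Coinvariants.mk _ (x ⊗ₜ y)) =
      Representation.Coinvariants.mk _
        (PiTensorProduct.map (fun _ => f) x ⊗ₜ stdRep k M n b (1, π) y) := rfl

theorem schurDegMap_id (M : E0Mod k) (n b : ℕ) (V : Type u) [AddCommGroup V] [Module k V] :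
    schurDegMap k M n b (LinearMap.id : V →ₗ[k] V) 1 = LinearMap.id := by
  refine Representation.Coinvariants.hom_ext (TensorProduct.ext' fun x y => ?_)
  refine (schurDegMap_mk k M n b _ _ x y).trans ?_
  rw [PiTensorProduct.map_id, Prod.mk_one_one, map_one]
  rfl

theorem schurDegMap_comp (M : E0Mod k) (n b : ℕ) {U V W : Type u} [AddCommGroup U] [Module k U]
    [AddCommGroup V] [Module k V] [AddCommGroup W] [Module k W] (g : V →ₗ[k] W) (f : U →ₗ[k] V)
    (π ρ : Equiv.Perm (Fin b)) :
    schurDegMap k M n b (g ∘ₗ f) (π * ρ) = schurDegMap k M n b g π ∘ₗ schurDegMap k M n b f ρ := by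
  refine Representation.Coinvariants.hom_ext (TensorProduct.ext' fun x y => ?_)
  refine (schurDegMap_mk k M n b _ _ x y).trans ?_
  rw [PiTensorProduct.map_comp, ← one_mul (1 : Equiv.Perm (Fin n)), ← Prod.mk_mul_mk, map_mul]
  rfl

/-- The underlying space `⨁ₙ V^{⊗n} ⊗_{𝔖_n} M(n, b)` of the Schur functor. -/
abbrev Schur (M : E0Mod k) (b : ℕ) (V : Type u) [AddCommGroup V] [Module k V] : Type u :=
  DirectSum ℕ fun n => SchurDeg k M n b V

/-- The map between values of the Schur functor given by a linear map `f : V → W` and a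
permutation `π` of `{1, …, b}`. -/
def schurMap (M : E0Mod k) (b : ℕ) {V W : Type u} [AddCommGroup V] [Module k V]
    [AddCommGroup W] [Module k W] (f : V →ₗ[k] W) (π : Equiv.Perm (Fin b)) :
    Schur k M b V →ₗ[k] Schur k M b W :=
  DirectSum.lmap fun n => schurDegMap k M n b f π

theorem schurMap_id (M : E0Mod k) (b : ℕ) (V : Type u) [AddCommGroup V] [Module k V] :
    schurMap k M b (LinearMap.id : V →ₗ[k] V) 1 = LinearMap.id := by
  unfold schurMap
  simp only [schurDegMap_id]
  exact DirectSum.lmap_id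

theorem schurMap_comp (M : E0Mod k) (b : ℕ) {U V W : Type u} [AddCommGroup U] [Module k U]
    [AddCommGroup V] [Module k V] [AddCommGroup W] [Module k W] (g : V →ₗ[k] W) (f : U →ₗ[k] V)
    (π ρ : Equiv.Perm (Fin b)) :
    schurMap k M b (g ∘ₗ f) (π * ρ) = schurMap k M b g π ∘ₗ schurMap k M b f ρ := by
  unfold schurMap
  simp only [schurDegMap_comp]
  exact DirectSum.lmap_comp _ _

/-- The action of `𝔖_b` on the value of the Schur functor. -/
def schurValRep (M : E0Mod k) (b : ℕ) (V : Type u) [AddCommGroup V] [Module k V] :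
    Representation k (Equiv.Perm (Fin b)) (Schur k M b V) where
  toFun π := schurMap k M b LinearMap.id π
  map_one' := schurMap_id k M b V
  map_mul' π ρ := schurMap_comp k M b LinearMap.id LinearMap.id π ρ

/-- The Schur functor `V ↦ ⨁ₙ V^{⊗n} ⊗_{𝔖_n} M(n, b)` associated to `M(-, b)`, for an `E₀`-module
`M`, with values in representations of `𝔖_b`. -/
def schurFunctor (M : E0Mod k) (b : ℕ) : FGModuleCat.{u} k ⥤ Rep.{u} k (Equiv.Perm (Fin b)) where
  obj V := Rep.of (schurValRep k M b V)
  map {V W} f := Rep.ofHom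
    { toLinearMap := schurMap k M b f.hom.hom 1
      isIntertwining' := fun π => by
        refine (schurMap_comp k M b f.hom.hom LinearMap.id 1 π).symm.trans
          (Eq.trans ?_ (schurMap_comp k M b LinearMap.id f.hom.hom π 1))
        rw [one_mul, mul_one]
        rfl }
  map_id V := Rep.hom_ext (Representation.IntertwiningMap.ext (schurMap_id k M b V))
  map_comp {U V W} f g := Rep.hom_ext (Representation.IntertwiningMap.ext
    (schurMap_comp k M b g.hom.hom f.hom.hom 1 1))

/-! ## The free Lie algebra on a vector space -/

section Lie

variable (V W : Type u) [AddCommGroup V] [Module k V] [AddCommGroup W] [Module k W]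

/-- The Lie ideal of the free Lie algebra on the underlying set of `V` that is generated by the
linear relations of `V`. -/
def linIdeal : LieIdeal k (FreeLieAlgebra k V) :=
  LieSubmodule.lieSpan k (FreeLieAlgebra k V)
    ({x | ∃ v w : V, x = FreeLieAlgebra.of k (v + w) - FreeLieAlgebra.of k v -
        FreeLieAlgebra.of k w} ∪
      {x | ∃ (c : k) (v : V), x = FreeLieAlgebra.of k (c • v) - c • FreeLieAlgebra.of k v})

/-- The free Lie algebra `Lie(V)` on the vector space `V`. -/
def FreeLie : Type u := FreeLieAlgebra k V ⧸ linIdeal k V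

instance : LieRing (FreeLie k V) := inferInstanceAs (LieRing (FreeLieAlgebra k V ⧸ linIdeal k V))

instance : LieAlgebra k (FreeLie k V) :=
  inferInstanceAs (LieAlgebra k (FreeLieAlgebra k V ⧸ linIdeal k V))

/-- The projection from the free Lie algebra on the underlying set of `V`. -/
def FreeLie.proj : FreeLieAlgebra k V →ₗ⁅k⁆ FreeLie k V where
  toFun x := (LieSubmodule.Quotient.mk x : FreeLieAlgebra k V ⧸ linIdeal k V)
  map_add' _ _ := rfl
  map_smul' _ _ := rfl
  map_lie' := rfl

theorem FreeLie.proj_surjective : Function.Surjective (FreeLie.proj k V) := Quot.mk_surjective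

theorem FreeLie.proj_eq_zero {x : FreeLieAlgebra k V} (hx : x ∈ linIdeal k V) :
    FreeLie.proj k V x = 0 :=
  LieSubmodule.Quotient.mk_eq_zero'.2 hx

/-- The inclusion of the generators `V → Lie(V)`. -/
def FreeLie.of : V →ₗ[k] FreeLie k V where
  toFun v := FreeLie.proj k V (FreeLieAlgebra.of k v)
  map_add' v w := by
    have h := FreeLie.proj_eq_zero k V (LieSubmodule.subset_lieSpan (Or.inl ⟨v, w, rfl⟩))
    rw [map_sub, map_sub, sub_sub, sub_eq_zero] at h
    exact h
  map_smul' c v := by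
    have h := FreeLie.proj_eq_zero k V (LieSubmodule.subset_lieSpan (Or.inr ⟨c, v, rfl⟩))
    rw [map_sub, map_smul, sub_eq_zero] at h
    exact h

variable {V W}

theorem FreeLie.hom_ext {L : Type*} [LieRing L] [LieAlgebra k L] {f g : FreeLie k V →ₗ⁅k⁆ L}
    (h : ∀ v, f (FreeLie.of k V v) = g (FreeLie.of k V v)) : f = g := by
  have h1 : f.comp (FreeLie.proj k V) = g.comp (FreeLie.proj k V) :=
    FreeLieAlgebra.hom_ext fun v => h v
  refine LieHom.ext fun x => ?_
  obtain ⟨x, rfl⟩ := FreeLie.proj_surjective k V x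
  exact LieHom.congr_fun h1 x

/-- The universal property of `Lie(V)`: a linear map from `V` to a Lie algebra extends to a
morphism of Lie algebras. -/
def FreeLie.lift {L : Type*} [LieRing L] [LieAlgebra k L] (f : V →ₗ[k] L) : FreeLie k V →ₗ⁅k⁆ L :=
  have hle : linIdeal k V ≤ (FreeLieAlgebra.lift k (f : V → L)).ker := by
    unfold linIdeal
    rw [LieSubmodule.lieSpan_le]
    rintro _ (⟨v, w, rfl⟩ | ⟨c, v, rfl⟩)
    · rw [SetLike.mem_coe, LieHom.mem_ker, map_sub, map_sub, FreeLieAlgebra.lift_of_apply,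
        FreeLieAlgebra.lift_of_apply, FreeLieAlgebra.lift_of_apply, map_add, add_sub_cancel_left,
        sub_self]
    · rw [SetLike.mem_coe, LieHom.mem_ker, map_sub, map_smul, FreeLieAlgebra.lift_of_apply,
        FreeLieAlgebra.lift_of_apply, map_smul, sub_self]
  have hker : (linIdeal k V).toSubmodule ≤
      LinearMap.ker (FreeLieAlgebra.lift k (f : V → L)).toLinearMap := fun _ hx =>
    (LieHom.mem_ker).1 (hle hx)
  { (linIdeal k V).toSubmodule.liftQ (FreeLieAlgebra.lift k (f : V → L)).toLinearMap hker with
    map_lie' := by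
      intro x y
      obtain ⟨x, rfl⟩ := FreeLie.proj_surjective k V x
      obtain ⟨y, rfl⟩ := FreeLie.proj_surjective k V y
      exact (FreeLieAlgebra.lift k (f : V → L)).map_lie x y }

theorem FreeLie.lift_of {L : Type*} [LieRing L] [LieAlgebra k L] (f : V →ₗ[k] L) (v : V) :
    FreeLie.lift k f (FreeLie.of k V v) = f v :=
  FreeLieAlgebra.lift_of_apply (R := k) (f : V → L) v

/-- The morphism `Lie(V) → Lie(W)` induced by a linear map `V → W`. -/
def FreeLie.map (f : V →ₗ[k] W) : FreeLie k V →ₗ⁅k⁆ FreeLie k W :=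
  FreeLie.lift k (FreeLie.of k W ∘ₗ f)

theorem FreeLie.map_of (f : V →ₗ[k] W) (v : V) :
    FreeLie.map k f (FreeLie.of k V v) = FreeLie.of k W (f v) := FreeLie.lift_of k _ v

theorem FreeLie.map_id : FreeLie.map k (LinearMap.id : V →ₗ[k] V) = LieHom.id :=
  FreeLie.hom_ext k fun v => FreeLie.map_of k _ v

theorem FreeLie.map_comp {U : Type u} [AddCommGroup U] [Module k U] (g : V →ₗ[k] W)
    (f : U →ₗ[k] V) : FreeLie.map k (g ∘ₗ f) = (FreeLie.map k g).comp (FreeLie.map k f) :=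
  FreeLie.hom_ext k fun v => by
    rw [FreeLie.map_of, LieHom.comp_apply, FreeLie.map_of, FreeLie.map_of]
    rfl

/-! ## The truncation `Lie_{≤2}(V)` -/

variable (V) in
/-- The Lie ideal of `Lie(V)` spanned by the brackets of length at least three. -/
abbrev lieGeThree : LieSubmodule k (FreeLie k V) (FreeLie k V) :=
  LieModule.lowerCentralSeries k (FreeLie k V) (FreeLie k V) 2

variable (V) in
/-- The quotient `Lie_{≤2}(V)` of `Lie(V)`, as a `Lie(V)`-module for the adjoint action. -/
def LieLeTwo : Type u := FreeLie k V ⧸ lieGeThree k V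

instance : AddCommGroup (LieLeTwo k V) :=
  inferInstanceAs (AddCommGroup (FreeLie k V ⧸ lieGeThree k V))

instance : Module k (LieLeTwo k V) := inferInstanceAs (Module k (FreeLie k V ⧸ lieGeThree k V))

instance : LieRingModule (FreeLie k V) (LieLeTwo k V) :=
  inferInstanceAs (LieRingModule (FreeLie k V) (FreeLie k V ⧸ lieGeThree k V))

instance : LieModule k (FreeLie k V) (LieLeTwo k V) :=
  inferInstanceAs (LieModule k (FreeLie k V) (FreeLie k V ⧸ lieGeThree k V))

variable (V) in
/-- The projection `Lie(V) → Lie_{≤2}(V)`. -/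
def LieLeTwo.mk : FreeLie k V →ₗ⁅k, FreeLie k V⁆ LieLeTwo k V :=
  LieSubmodule.Quotient.mk' (lieGeThree k V)

theorem LieLeTwo.mk_surjective : Function.Surjective (LieLeTwo.mk k V) := Quot.mk_surjective

/-- The map `Lie_{≤2}(V) → Lie_{≤2}(W)` induced by a linear map `V → W`. -/
def LieLeTwo.map (f : V →ₗ[k] W) : LieLeTwo k V →ₗ[k] LieLeTwo k W :=
  Submodule.mapQ (lieGeThree k V).toSubmodule (lieGeThree k W).toSubmodule
    (FreeLie.map k f).toLinearMap (Submodule.map_le_iff_le_comap.1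
      (lieModule_lcs_map_le (f := FreeLie.map k f) (g := (FreeLie.map k f).toLinearMap)
        (fun x m => ((FreeLie.map k f).map_lie x m).symm) 2))

theorem LieLeTwo.map_mk (f : V →ₗ[k] W) (x : FreeLie k V) :
    LieLeTwo.map k f (LieLeTwo.mk k V x) = LieLeTwo.mk k W (FreeLie.map k f x) := rfl

theorem LieLeTwo.map_id : LieLeTwo.map k (LinearMap.id : V →ₗ[k] V) = LinearMap.id := by
  refine LinearMap.ext fun x => ?_
  obtain ⟨x, rfl⟩ := LieLeTwo.mk_surjective k x
  rw [LieLeTwo.map_mk, FreeLie.map_id]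
  rfl

theorem LieLeTwo.map_comp {U : Type u} [AddCommGroup U] [Module k U] (g : V →ₗ[k] W)
    (f : U →ₗ[k] V) : LieLeTwo.map k (g ∘ₗ f) = LieLeTwo.map k g ∘ₗ LieLeTwo.map k f := by
  refine LinearMap.ext fun x => ?_
  obtain ⟨x, rfl⟩ := LieLeTwo.mk_surjective k x
  rw [LinearMap.comp_apply, LieLeTwo.map_mk, LieLeTwo.map_mk, LieLeTwo.map_mk, FreeLie.map_comp]
  rfl

theorem LieLeTwo.map_lie (f : V →ₗ[k] W) (x : FreeLie k V) (m : LieLeTwo k V) :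
    LieLeTwo.map k f ⁅x, m⁆ = ⁅FreeLie.map k f x, LieLeTwo.map k f m⁆ := by
  obtain ⟨m, rfl⟩ := LieLeTwo.mk_surjective k m
  rw [← LieModuleHom.map_lie, LieLeTwo.map_mk, LieLeTwo.map_mk, ← LieModuleHom.map_lie,
    LieHom.map_lie]

end Lie

/-! ## Tensor powers of Lie modules and coinvariants -/

section Diag

variable {k} {ι M N : Type*} [Fintype ι] [DecidableEq ι] [AddCommGroup M] [Module k M]
  [AddCommGroup N] [Module k N]

/-- The endomorphism `∑ᵢ id ⊗ ⋯ ⊗ f ⊗ ⋯ ⊗ id` of `M^{⊗ι}`. -/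
def diagEnd (f : Module.End k M) : Module.End k (⨂[k] _ : ι, M) :=
  ∑ i, PiTensorProduct.map (Function.update (fun _ => (1 : Module.End k M)) i f)

theorem diagEnd_tprod (f : Module.End k M) (m : ι → M) :
    diagEnd f (PiTensorProduct.tprod k m) =
      ∑ i, PiTensorProduct.tprod k (Function.update m i (f (m i))) := by
  unfold diagEnd
  rw [LinearMap.sum_apply]
  refine Finset.sum_congr rfl fun i _ => ?_
  rw [PiTensorProduct.map_tprod]
  congr 1
  ext j
  by_cases h : j = i
  · subst h
    simp
  · simp [h]

theorem diagEnd_add (f g : Module.End k M) :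
    diagEnd (ι := ι) (f + g) = diagEnd f + diagEnd g := by
  unfold diagEnd
  rw [← Finset.sum_add_distrib]
  exact Finset.sum_congr rfl fun i _ => PiTensorProduct.map_update_add _ _ _ _

theorem diagEnd_smul (r : k) (f : Module.End k M) :
    diagEnd (ι := ι) (r • f) = r • diagEnd f := by
  unfold diagEnd
  rw [Finset.smul_sum]
  exact Finset.sum_congr rfl fun i _ => PiTensorProduct.map_update_smul _ _ _ _

theorem diagEnd_commutator (f g : Module.End k M) :
    diagEnd (ι := ι) (f * g - g * f) = diagEnd f * diagEnd g - diagEnd g * diagEnd f := by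
  have hmul : ∀ f g : Module.End k M, diagEnd (ι := ι) f * diagEnd g = diagEnd (f * g) +
      ∑ i, ∑ j ∈ Finset.univ.erase i, PiTensorProduct.map
        (Function.update (Function.update (fun _ => (1 : Module.End k M)) i f) j g) := by
    intro f g
    unfold diagEnd
    rw [Finset.sum_mul_sum, ← Finset.sum_add_distrib]
    refine Finset.sum_congr rfl fun i _ => ?_
    rw [← Finset.add_sum_erase _ _ (Finset.mem_univ i), ← PiTensorProduct.map_mul]
    congr 1
    · congr 1
      ext1 l
      by_cases h : l = i
      · subst h
        simp
      · simp [h]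
    · refine Finset.sum_congr rfl fun j hj => ?_
      rw [← PiTensorProduct.map_mul]
      congr 1
      ext1 l
      have hij := Finset.ne_of_mem_erase hj
      by_cases h : l = j
      · subst h
        simp [hij]
      · simp [h]
  have hsym : (∑ i, ∑ j ∈ Finset.univ.erase i, PiTensorProduct.map
        (Function.update (Function.update (fun _ : ι => (1 : Module.End k M)) i f) j g)) =
      ∑ i, ∑ j ∈ Finset.univ.erase i, PiTensorProduct.map
        (Function.update (Function.update (fun _ : ι => (1 : Module.End k M)) i g) j f) := by
    rw [Finset.sum_comm' (t' := Finset.univ) (s' := fun j => Finset.univ.erase j)]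
    · refine Finset.sum_congr rfl fun i _ => Finset.sum_congr rfl fun j hj => ?_
      rw [Function.update_comm (Finset.ne_of_mem_erase hj)]
    · intro i j
      simp [ne_comm]
  have hsub : diagEnd (ι := ι) (f * g - g * f) = diagEnd (f * g) - diagEnd (g * f) := by
    rw [eq_sub_iff_add_eq, ← diagEnd_add, sub_add_cancel]
  rw [hmul f g, hmul g f, hsym, hsub]
  abel

theorem diagEnd_map (f : Module.End k M) (f' : Module.End k N) (φ : M →ₗ[k] N)
    (h : φ ∘ₗ f = f' ∘ₗ φ) (x : ⨂[k] _ : ι, M) :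
    PiTensorProduct.map (fun _ => φ) (diagEnd f x) =
      diagEnd f' (PiTensorProduct.map (fun _ => φ) x) := by
  suffices h1 : PiTensorProduct.map (fun _ : ι => φ) ∘ₗ diagEnd f =
      diagEnd f' ∘ₗ PiTensorProduct.map (fun _ => φ) from LinearMap.congr_fun h1 x
  refine PiTensorProduct.ext (MultilinearMap.ext fun m => ?_)
  simp only [LinearMap.compMultilinearMap_apply, LinearMap.comp_apply, diagEnd_tprod, map_sum,
    PiTensorProduct.map_tprod]
  refine Finset.sum_congr rfl fun i _ => ?_
  congr 1
  ext j
  by_cases hj : j = i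
  · subst hj
    simpa using LinearMap.congr_fun h (m j)
  · simp [hj]

theorem diagEnd_place (f : Module.End k M) (σ : Equiv.Perm ι) (x : ⨂[k] _ : ι, M) :
    placeRep (k := k) ι M σ (diagEnd f x) = diagEnd f (placeRep (k := k) ι M σ x) := by
  suffices h1 : placeRep (k := k) ι M σ ∘ₗ diagEnd f = diagEnd f ∘ₗ placeRep (k := k) ι M σ from
    LinearMap.congr_fun h1 x
  have hp : ∀ m : ι → M, placeRep (k := k) ι M σ (PiTensorProduct.tprod k m) =
      PiTensorProduct.tprod k fun i => m (σ.symm i) := fun m =>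
    PiTensorProduct.reindex_tprod (R := k) (s := fun _ : ι => M) σ m
  refine PiTensorProduct.ext (MultilinearMap.ext fun m => ?_)
  simp only [LinearMap.compMultilinearMap_apply, LinearMap.comp_apply, diagEnd_tprod, map_sum, hp]
  refine Fintype.sum_equiv σ _ _ fun i => ?_
  congr 1
  ext j
  by_cases hj : j = σ i
  · subst hj
    simp
  · have hj' : σ.symm j ≠ i := fun h => hj (by rw [← h, Equiv.apply_symm_apply])
    simp [hj, hj']

variable {L : Type*} [LieRing L] [LieAlgebra k L] [LieRingModule L M] [LieModule k L M]

/-- The diagonal action of a Lie algebra `L` on a tensor power `M^{⊗ι}` of an `L`-module `M`: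
`⁅x, m₁ ⊗ ⋯ ⊗ m_b⁆ = ∑ᵢ m₁ ⊗ ⋯ ⊗ ⁅x, mᵢ⁆ ⊗ ⋯ ⊗ m_b`. -/
instance diagLieRingModule : LieRingModule L (⨂[k] _ : ι, M) where
  bracket x t := diagEnd (LieModule.toEnd k L M x) t
  add_lie x y t := by
    change diagEnd _ t = diagEnd _ t + diagEnd _ t
    rw [map_add, diagEnd_add, LinearMap.add_apply]
  lie_add x s t := map_add _ s t
  leibniz_lie x y t := by
    change diagEnd _ (diagEnd _ t) = diagEnd _ t + diagEnd _ (diagEnd _ t)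
    have h : LieModule.toEnd k L M ⁅x, y⁆ = LieModule.toEnd k L M x * LieModule.toEnd k L M y -
        LieModule.toEnd k L M y * LieModule.toEnd k L M x :=
      LinearMap.ext fun m => lie_lie x y m
    rw [h, diagEnd_commutator, LinearMap.sub_apply, Module.End.mul_apply, Module.End.mul_apply,
      sub_add_cancel]

theorem diag_lie_def (x : L) (t : ⨂[k] _ : ι, M) :
    ⁅x, t⁆ = diagEnd (LieModule.toEnd k L M x) t := rfl

instance diagLieModule : LieModule k L (⨂[k] _ : ι, M) where
  smul_lie r x t := by
    rw [diag_lie_def, map_smul, diagEnd_smul]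
    rfl
  lie_smul r x t := map_smul _ r t

end Diag

section H0

variable (L M : Type*) [LieRing L] [LieAlgebra k L] [AddCommGroup M] [Module k M]
  [LieRingModule L M] [LieModule k L M]

/-- The zeroth homology `H₀(L; M) = M / L·M` of a Lie algebra `L` with coefficients in an
`L`-module `M`. -/
abbrev LieH0 :=
  M ⧸ (⁅(⊤ : LieIdeal k L), (⊤ : LieSubmodule k L M)⁆ : LieSubmodule k L M).toSubmodule

variable {L M} {L' M' : Type*} [LieRing L'] [LieAlgebra k L'] [AddCommGroup M'] [Module k M']
  [LieRingModule L' M']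

/-- The functoriality of `H₀`. -/
def LieH0.map (φ : M →ₗ[k] M') (h : ∀ x : L, ∃ y : L', ∀ m, φ ⁅x, m⁆ = ⁅y, φ m⁆) :
    LieH0 k L M →ₗ[k] LieH0 k L' M' :=
  Submodule.mapQ _ _ φ (by
    rw [LieSubmodule.lieIdeal_oper_eq_linear_span', Submodule.span_le]
    rintro _ ⟨x, -, m, -, rfl⟩
    obtain ⟨y, hy⟩ := h x
    rw [SetLike.mem_coe, Submodule.mem_comap, hy]
    exact LieSubmodule.lie_mem_lie trivial trivial)

theorem LieH0.map_mk (φ : M →ₗ[k] M') (h : ∀ x : L, ∃ y : L', ∀ m, φ ⁅x, m⁆ = ⁅y, φ m⁆) (m : M) :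
    LieH0.map k φ h (Submodule.Quotient.mk m) = Submodule.Quotient.mk (φ m) := rfl

end H0

/-! ## The functor `V ↦ H₀(Lie(V); Lie_{≤2}(V)^{⊗b})` -/

section

variable (b : ℕ) {U V W : Type u} [AddCommGroup U] [Module k U] [AddCommGroup V] [Module k V]
  [AddCommGroup W] [Module k W]

variable (V) in
/-- The space `H₀(Lie(V); Lie_{≤2}(V)^{⊗b})`. -/
abbrev LieVal : Type u := LieH0 k (FreeLie k V) (⨂[k] _ : Fin b, LieLeTwo k V)

/-- The map `H₀(Lie(V); Lie_{≤2}(V)^{⊗b}) → H₀(Lie(W); Lie_{≤2}(W)^{⊗b})` given by a linear map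
`f : V → W` and a permutation `π` of `{1, …, b}`. -/
def lieValMap (f : V →ₗ[k] W) (π : Equiv.Perm (Fin b)) : LieVal k b V →ₗ[k] LieVal k b W :=
  LieH0.map k
    (placeRep (Fin b) (LieLeTwo k W) π ∘ₗ PiTensorProduct.map fun _ => LieLeTwo.map k f)
    fun x => ⟨FreeLie.map k f x, fun m => by
      rw [LinearMap.comp_apply, LinearMap.comp_apply, diag_lie_def, diag_lie_def, ← diagEnd_place]
      exact congrArg _ (diagEnd_map _ _ (LieLeTwo.map k f)
        (LinearMap.ext fun y => LieLeTwo.map_lie k f x y) m)⟩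

theorem lieValMap_mk (f : V →ₗ[k] W) (π : Equiv.Perm (Fin b)) (m : ⨂[k] _ : Fin b, LieLeTwo k V) :
    lieValMap k b f π (Submodule.Quotient.mk m) = Submodule.Quotient.mk
      (placeRep (Fin b) (LieLeTwo k W) π (PiTensorProduct.map (fun _ => LieLeTwo.map k f) m)) :=
  rfl

theorem lieValMap_id : lieValMap k b (LinearMap.id : V →ₗ[k] V) 1 = LinearMap.id := by
  refine Submodule.linearMap_qext _ (LinearMap.ext fun m => ?_)
  refine (lieValMap_mk k b _ _ m).trans ?_
  rw [LieLeTwo.map_id, PiTensorProduct.map_id, map_one]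
  rfl

theorem lieValMap_comp (g : V →ₗ[k] W) (f : U →ₗ[k] V) (π ρ : Equiv.Perm (Fin b)) :
    lieValMap k b (g ∘ₗ f) (π * ρ) = lieValMap k b g π ∘ₗ lieValMap k b f ρ := by
  refine Submodule.linearMap_qext _ (LinearMap.ext fun m => ?_)
  refine (lieValMap_mk k b _ _ m).trans (Eq.trans ?_ (lieValMap_mk k b g π _).symm)
  rw [LinearMap.comp_apply, ← placeRep_map, LieLeTwo.map_comp, PiTensorProduct.map_comp, map_mul]
  rfl

variable (V) in
/-- The action of `𝔖_b` on `H₀(Lie(V); Lie_{≤2}(V)^{⊗b})` by place permutations. -/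
def lieValRep : Representation k (Equiv.Perm (Fin b)) (LieVal k b V) where
  toFun π := lieValMap k b LinearMap.id π
  map_one' := lieValMap_id k b
  map_mul' π ρ := lieValMap_comp k b LinearMap.id LinearMap.id π ρ

end

/-- The functor `V ↦ H₀(Lie(V); Lie_{≤2}(V)^{⊗b})`, with values in representations of `𝔖_b`. -/
def lieH0Functor (b : ℕ) : FGModuleCat.{u} k ⥤ Rep.{u} k (Equiv.Perm (Fin b)) where
  obj V := Rep.of (lieValRep k b V)
  map {V W} f := Rep.ofHom
    { toLinearMap := lieValMap k b f.hom.hom 1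
      isIntertwining' := fun π => by
        refine (lieValMap_comp k b f.hom.hom LinearMap.id 1 π).symm.trans
          (Eq.trans ?_ (lieValMap_comp k b LinearMap.id f.hom.hom π 1))
        rw [one_mul, mul_one]
        rfl }
  map_id V := Rep.hom_ext (Representation.IntertwiningMap.ext (lieValMap_id k b))
  map_comp {U V W} f g := Rep.hom_ext (Representation.IntertwiningMap.ext
    (lieValMap_comp k b g.hom.hom f.hom.hom 1 1))

end BabyBeads

end

/-! The functor `hFunctor` divides `Beads^±` by the images of all morphisms outside `𝔇₀`. Such a
morphism misses some bead `u`, so it factors through a morphism that adds `u` and no column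
(`exists_factor_of_not_isD0`). Only one kind of relation therefore has to be understood: the sum
over all ways of placing one new bead above a column with a single bead is zero.

The Schur functor labels the beads by vectors. A column with one bead `v` is read as `v` in
`Lie_{≤2}(V)`, and a column with top bead `v` and bottom bead `w` as `⁅v, w⁆`. A labelled
arrangement then gives a pure tensor (`beadTensor`), and the relation `φ + tφ = 0` becomes
antisymmetry of the bracket (`beadTensor_relabel_swap`). The diagonal action of `v` replaces a
column `w` by `⁅v, w⁆` and kills a column `⁅w, w'⁆`, since brackets of length three vanish; hence it
is exactly the sum over all placements of a new bead labelled `v` (`sum_beadTensor_extends`). The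
added-bead relations thus hold in `H₀`, and `schurToLie` is defined. It involves no choices, so
naturality and equivariance can be read off on arrangements.

For the inverse, `Lie_{≤2}(V)` is mapped to `V ⊕ V ⊗ V`, where the bracket goes to `(v ⊗ w - w ⊗ v)
/ 2`. A basis of `V` gives a basis of `V ⊕ V ⊗ V` made of columns, and a linear map from the tensor
power to the Schur functor may be prescribed on products of basis columns. This is possible because
a class in the Schur functor depends only on the contents of its columns and not on the numbering of
its beads (`schurClass_eq_of_content`). The prescribed map is invariant under the signed exchange of
the beads of any one column, so replacing a column by its average with its exchange changes nothing
(`multilinear_average`). Hence `tensorToSchur` sends the tensor of a labelled arrangement to its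
class (`tensorToSchur_beadTensor`). It kills the action of `V` by the added-bead relation, and then
that of `Lie(V)`, which `V` generates. Both composites are identities because labelled arrangements
generate both sides. -/

noncomputable section

namespace BabyBeads

/-! ## Arrangements of beads and the contents of their columns -/

namespace Beads

/-- The transport of an arrangement along a pair of bijections. -/
def transport {A B : FinPair} (σ : A.X ≃ B.X) (π : A.Y ≃ B.Y) (φ : Beads A) : Beads B where
  pos := ⟨fun x => (π (φ.pos (σ.symm x)).1, (φ.pos (σ.symm x)).2), fun x x' h => by
    have h1 := congrArg Prod.fst h
    have h2 := congrArg Prod.snd h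
    exact σ.symm.injective (φ.pos.injective (Prod.ext (π.injective h1) h2))⟩
  bottom y := by
    obtain ⟨x, hx⟩ := φ.bottom (π.symm y)
    refine ⟨σ x, ?_⟩
    change (π (φ.pos (σ.symm (σ x))).1, (φ.pos (σ.symm (σ x))).2) = _
    rw [σ.symm_apply_apply, hx, π.apply_symm_apply]

theorem transport_pos {A B : FinPair} (σ : A.X ≃ B.X) (π : A.Y ≃ B.Y) (φ : Beads A) (x : A.X) :
    (φ.transport σ π).pos (σ x) = (π (φ.pos x).1, (φ.pos x).2) := by
  change (π (φ.pos (σ.symm (σ x))).1, (φ.pos (σ.symm (σ x))).2) = _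
  rw [σ.symm_apply_apply]

theorem extends_isoHom {A B : FinPair} (σ : A.X ≃ B.X) (π : A.Y ≃ B.Y) (φ : Beads A)
    (ψ : Beads B) : Extends (isoHom σ π) φ ψ ↔ ψ = φ.transport σ π := by
  constructor
  · intro h
    ext1
    ext1 x
    obtain ⟨x, rfl⟩ := σ.surjective x
    exact (h.1 x).trans (transport_pos σ π φ x).symm
  · rintro rfl
    exact ⟨fun x => transport_pos σ π φ x, fun p => (p.2.2 ⟨π.symm p.2.1, by
      exact π.apply_symm_apply _⟩).elim⟩

variable {A : FinPair} {S T : Type*}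

/-- The bead at the bottom of a column. -/
def bot (φ : Beads A) (y : A.Y) : A.X := (φ.bottom y).choose

theorem pos_bot (φ : Beads A) (y : A.Y) : φ.pos (φ.bot y) = (y, 0) := (φ.bottom y).choose_spec

theorem bot_eq {φ : Beads A} {x : A.X} {y : A.Y} (h : φ.pos x = (y, 0)) : φ.bot y = x :=
  φ.pos.injective ((φ.pos_bot y).trans h.symm)

/-- The bottom place is always occupied, so only the top place is in question. Computations of
contents split along these two cases. -/
theorem column_cases (φ : Beads A) (y : A.Y) :
    (∃ x, φ.pos x = (y, 0) ∧ ∀ x', φ.pos x' ≠ (y, 1)) ∨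
      ∃ x x', φ.pos x = (y, 0) ∧ φ.pos x' = (y, 1) := by
  by_cases h : ∃ x', φ.pos x' = (y, 1)
  · obtain ⟨x', hx'⟩ := h
    exact Or.inr ⟨_, x', φ.pos_bot y, hx'⟩
  · exact Or.inl ⟨_, φ.pos_bot y, fun x' hx' => h ⟨x', hx'⟩⟩

open Classical in
/-- The labels of the beads in a column, the beads being labelled by `v`: either that of the only
bead, or those of the top bead and of the bottom bead. -/
def content (φ : Beads A) (v : A.X → S) (y : A.Y) : S ⊕ S × S :=
  if h : ∃ x, φ.pos x = (y, 1) then Sum.inr (v h.choose, v (φ.bot y)) else Sum.inl (v (φ.bot y))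

theorem content_one {φ : Beads A} (v : A.X → S) {x : A.X} {y : A.Y} (hx : φ.pos x = (y, 0))
    (h : ∀ x', φ.pos x' ≠ (y, 1)) : φ.content v y = Sum.inl (v x) := by
  rw [content, dif_neg fun ⟨x', hx'⟩ => h x' hx', bot_eq hx]

theorem content_two {φ : Beads A} (v : A.X → S) {x x' : A.X} {y : A.Y} (hx : φ.pos x = (y, 0))
    (hx' : φ.pos x' = (y, 1)) : φ.content v y = Sum.inr (v x', v x) := by
  have h : ∃ x, φ.pos x = (y, 1) := ⟨x', hx'⟩
  rw [content, dif_pos h, bot_eq hx, φ.pos.injective (h.choose_spec.trans hx'.symm)]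

theorem content_comp (φ : Beads A) (v : A.X → S) (g : S → T) (y : A.Y) :
    φ.content (fun x => g (v x)) y = Sum.map g (Prod.map g g) (φ.content v y) := by
  rcases φ.column_cases y with ⟨x, hx, h⟩ | ⟨x, x', hx, hx'⟩
  · rw [content_one _ hx h, content_one _ hx h, Sum.map_inl]
  · rw [content_two _ hx hx', content_two _ hx hx', Sum.map_inr, Prod.map_apply]

theorem content_congr {φ : Beads A} {v w : A.X → S} {y : A.Y}
    (h : ∀ x, (φ.pos x).1 = y → v x = w x) : φ.content v y = φ.content w y := by
  rcases φ.column_cases y with ⟨x, hx, h1⟩ | ⟨x, x', hx, hx'⟩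
  · rw [content_one _ hx h1, content_one _ hx h1, h x (by rw [hx])]
  · rw [content_two _ hx hx', content_two _ hx hx', h x (by rw [hx]), h x' (by rw [hx'])]

theorem content_transport {B : FinPair} (σ : A.X ≃ B.X) (π : A.Y ≃ B.Y) (φ : Beads A)
    (v : B.X → S) (y : A.Y) :
    (φ.transport σ π).content v (π y) = φ.content (fun x => v (σ x)) y := by
  rcases φ.column_cases y with ⟨x, hx, h⟩ | ⟨x, x', hx, hx'⟩
  · rw [content_one (x := x) _ hx h, content_one (x := σ x) _ (by rw [transport_pos, hx])]
    intro x' hx'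
    obtain ⟨x', rfl⟩ := σ.surjective x'
    rw [transport_pos, Prod.mk.injEq, π.apply_eq_iff_eq] at hx'
    exact h x' (Prod.ext hx'.1 hx'.2)
  · rw [content_two (x := x) (x' := x') _ hx hx',
      content_two (x := σ x) (x' := σ x') _ (by rw [transport_pos, hx])
        (by rw [transport_pos, hx'])]

theorem relabel_eq_transport (σ : Equiv.Perm A.X) (φ : Beads A) :
    φ.relabel σ = φ.transport σ (Equiv.refl _) := by
  ext1
  ext1 x
  rfl

/-- Contents list the top bead first: column `y` held `(v b, v a)` before the exchange. The other
columns contain neither `a` nor `b`. -/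
theorem content_relabel_swap [DecidableEq A.X] [DecidableEq A.Y] {φ : Beads A} (v : A.X → S) {a b : A.X} {y : A.Y}
    (ha : φ.pos a = (y, 0)) (hb : φ.pos b = (y, 1)) :
    (φ.relabel (Equiv.swap a b)).content v =
      Function.update (φ.content v) y (Sum.inr (v a, v b)) := by
  funext z
  rw [relabel_eq_transport]
  refine (content_transport (Equiv.swap a b) (Equiv.refl _) φ v z).trans ?_
  by_cases h : z = y
  · subst h
    rw [Function.update_self, content_two _ ha hb, Equiv.swap_apply_left, Equiv.swap_apply_right]
  · rw [Function.update_of_ne h]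
    refine content_congr fun x hx => ?_
    rw [Equiv.swap_apply_of_ne_of_ne]
    · rintro rfl; rw [ha] at hx; exact h hx.symm
    · rintro rfl; rw [hb] at hx; exact h hx.symm

/-! ### Recovering a labelled arrangement from its contents -/

theorem exists_top_iff {B : FinPair} {φ : Beads A} {ψ : Beads B} {v : A.X → S} {w : B.X → S}
    {y : A.Y} {z : B.Y} (h : ψ.content w z = φ.content v y) :
    (∃ x, φ.pos x = (y, 1)) ↔ ∃ x, ψ.pos x = (z, 1) := by
  rcases φ.column_cases y with ⟨x, hx, h1⟩ | ⟨x, x', hx, hx'⟩ <;>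
  rcases ψ.column_cases z with ⟨u, hu, h2⟩ | ⟨u, u', hu, hu'⟩
  · exact ⟨fun ⟨x, hx⟩ => (h1 x hx).elim, fun ⟨x, hx⟩ => (h2 x hx).elim⟩
  · rw [content_one _ hx h1, content_two _ hu hu'] at h
    cases h
  · rw [content_one _ hu h2, content_two _ hx hx'] at h
    cases h
  · exact ⟨fun _ => ⟨_, hu'⟩, fun _ => ⟨_, hx'⟩⟩

/-- The summand in which a content lies records whether the top place is filled, so equal contents
force the same places to be occupied. Matching beads by their places gives the bijection of the next
theorem. -/
theorem exists_pos_of_content_eq {B : FinPair} {φ : Beads A} {ψ : Beads B} {v : A.X → S}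
    {w : B.X → S} {π : A.Y ≃ B.Y} (h : ∀ y, ψ.content w (π y) = φ.content v y) (x : A.X) :
    ∃ u, ψ.pos u = (π (φ.pos x).1, (φ.pos x).2) := by
  obtain ⟨⟨y, ε⟩, hx⟩ : ∃ p, φ.pos x = p := ⟨_, rfl⟩
  rw [hx]
  fin_cases ε
  · exact ψ.bottom _
  · exact (exists_top_iff (h y)).1 ⟨x, hx⟩

/-- Two labelled arrangements with the same contents differ by a bijection of the beads. -/
theorem exists_transport_of_content_eq {B : FinPair} {φ : Beads A} {ψ : Beads B} {v : A.X → S}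
    {w : B.X → S} {π : A.Y ≃ B.Y} (h : ∀ y, ψ.content w (π y) = φ.content v y) :
    ∃ σ : A.X ≃ B.X, ψ = φ.transport σ π ∧ v = fun x => w (σ x) := by
  have h' : ∀ y, φ.content v (π.symm y) = ψ.content w y := fun y => by
    rw [← h, Equiv.apply_symm_apply]
  choose f hf using exists_pos_of_content_eq h
  choose g hg using exists_pos_of_content_eq h'
  let σ : A.X ≃ B.X := ⟨f, g, fun x => φ.pos.injective (by rw [hg, hf]; simp),
    fun x => ψ.pos.injective (by rw [hf, hg]; simp)⟩
  have hσ : ∀ x, ψ.pos (σ x) = (π (φ.pos x).1, (φ.pos x).2) := hf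
  have hψ : ψ = φ.transport σ π := by
    ext1
    ext1 x
    obtain ⟨x, rfl⟩ := σ.surjective x
    rw [hσ, transport_pos]
  refine ⟨σ, hψ, funext fun x => ?_⟩
  obtain ⟨⟨y, ε⟩, hx⟩ : ∃ p, φ.pos x = p := ⟨_, rfl⟩
  have h2 := h y
  rw [hψ, content_transport] at h2
  fin_cases ε
  · rcases φ.column_cases y with ⟨z, hz, h1⟩ | ⟨z, z', hz, hz'⟩
    · rw [content_one _ hx h1, content_one _ hx h1] at h2
      exact (Sum.inl_injective h2).symm
    · rw [content_two _ hx hz', content_two _ hx hz'] at h2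
      exact (Prod.ext_iff.1 (Sum.inr_injective h2)).2.symm
  · rw [content_two _ (φ.pos_bot y) hx, content_two _ (φ.pos_bot y) hx] at h2
    exact (Prod.ext_iff.1 (Sum.inr_injective h2)).1.symm

/-- The places that ought to be filled can serve as the beads themselves, each sitting at its own
place; numbering them then gives beads in some `Fin n`. -/
theorem exists_content_eq {b : ℕ} {V : Type*} (c : Fin b → V ⊕ V × V) :
    ∃ (n : ℕ) (φ : Beads ⟨Fin n, Fin b⟩) (v : Fin n → V), ∀ y, φ.content v y = c y := by
  -- All the bottom places, and the top places of the columns whose prescribed content is a pair.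
  let X := {p : Fin b × Fin 2 // p.2 = 0 ∨ (c p.1).isRight}
  let w : X → V := fun p => Sum.elim id (fun q => if p.1.2 = 0 then q.2 else q.1) (c p.1.1)
  let ψ : Beads ⟨X, Fin b⟩ :=
    { pos := ⟨Subtype.val, Subtype.val_injective⟩
      bottom := fun y => ⟨⟨(y, 0), Or.inl rfl⟩, rfl⟩ }
  have hψ : ∀ y, ψ.content w y = c y := by
    intro y
    rcases hc : c y with a | ⟨a, a'⟩
    · rw [Beads.content_one (x := (⟨(y, 0), Or.inl rfl⟩ : X)) _ rfl]
      · simp [w, hc]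
      · rintro ⟨p, hp⟩ (h : p = (y, 1))
        subst h
        simp [hc] at hp
    · rw [Beads.content_two (x := (⟨(y, 0), Or.inl rfl⟩ : X))
        (x' := (⟨(y, 1), Or.inr (by simp [hc])⟩ : X)) _ rfl rfl]
      simp [w, hc]
  obtain ⟨n, ⟨σ⟩⟩ := Finite.exists_equiv_fin X
  refine ⟨n, ψ.transport (A := ⟨X, Fin b⟩) (B := ⟨Fin n, Fin b⟩) σ (Equiv.refl _),
    fun i => w (σ.symm i), fun y => ?_⟩
  refine (Beads.content_transport (A := ⟨X, Fin b⟩) (B := ⟨Fin n, Fin b⟩) σ (Equiv.refl _) ψ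
    _ y).trans ?_
  rw [← hψ]
  congr 1
  funext x
  exact congrArg w (σ.symm_apply_apply x)

end Beads

section

variable (k : Type u) [CommRing k]

/-- Bijections leave no bead to be placed, so the sum over extensions has a single term. -/
theorem beadsMap_isoHom {A B : FinPair} (σ : A.X ≃ B.X) (π : A.Y ≃ B.Y) (φ : Beads A) :
    beadsMap k (isoHom σ π) (Finsupp.single φ 1) = Finsupp.single (φ.transport σ π) 1 := by
  classical
  rw [beadsMap_single]
  refine (Finset.sum_congr ?_ fun _ _ => rfl).trans (Finset.sum_singleton
    (fun ψ : Beads B => (Finsupp.single ψ 1 : Beads B →₀ k)) (φ.transport σ π))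
  ext ψ
  simp only [Finset.mem_filter, Finset.mem_univ, true_and, Finset.mem_singleton,
    Beads.extends_isoHom]

end

/-! ## Adding one bead -/

/-- The morphism `i` adds the single bead `u` and no column. -/
structure AddsBead {A B : FinPair} (m : A ⟶ B) (u : B.X) (π : A.Y ≃ B.Y) : Prop where
  j_eq : ∀ y, m.j y = π y
  not_mem : ∀ x, m.i x ≠ u
  mem : ∀ x, x ≠ u → ∃ a, m.i a = x

namespace AddsBead

variable {A B : FinPair} {m : A ⟶ B} {u : B.X} {π : A.Y ≃ B.Y}

/-- There is no new column, so the condition on `ζ` is vacuous. -/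
theorem extends_iff (hm : AddsBead m u π) {φ : Beads A} {ψ : Beads B} :
    Extends m φ ψ ↔ ∀ x, ψ.pos (m.i x) = (π (φ.pos x).1, (φ.pos x).2) := by
  refine ⟨fun h x => (h.1 x).trans (by rw [hm.j_eq]), fun h => ⟨fun x => (h x).trans
    (by rw [hm.j_eq]), fun p => (p.2.2 ⟨π.symm p.2.1, ?_⟩).elim⟩⟩
  rw [hm.j_eq, π.apply_symm_apply]

theorem not_isD0 (hm : AddsBead m u π) : ¬ IsD0 m := fun h => by
  obtain ⟨p, -⟩ := h.2 ⟨u, fun ⟨x, hx⟩ => hm.not_mem x hx⟩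
  exact p.2.2 ⟨π.symm p.2.1, by rw [hm.j_eq, π.apply_symm_apply]⟩

/-- The old beads already fill every bottom place, so the new bead can only go on top of a column
that had one bead. With `exists_extends` and `extends_unique`, this makes the extensions of `φ`
correspond to its one-bead columns. -/
theorem pos_new (hm : AddsBead m u π) {φ : Beads A} {ψ : Beads B} (h : Extends m φ ψ) :
    (∀ x, φ.pos x ≠ (π.symm (ψ.pos u).1, 1)) ∧ (ψ.pos u).2 = 1 := by
  have hne : ∀ x, (φ.pos x) ≠ (π.symm (ψ.pos u).1, (ψ.pos u).2) := fun x hx =>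
    hm.not_mem x (ψ.pos.injective (by rw [hm.extends_iff.1 h, hx, π.apply_symm_apply]))
  have h1 : (ψ.pos u).2 = 1 := by
    by_contra h0
    have h0 : (ψ.pos u).2 = 0 := by omega
    obtain ⟨x, hx⟩ := φ.bottom (π.symm (ψ.pos u).1)
    exact hne x (by rw [hx, h0])
  exact ⟨fun x hx => hne x (by rw [hx, h1]), h1⟩

theorem exists_extends (hm : AddsBead m u π) {φ : Beads A} {y : A.Y} (hy : ∀ x, φ.pos x ≠ (y, 1)) :
    ∃ ψ, Extends m φ ψ ∧ ψ.pos u = (π y, 1) := by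
  classical
  -- Every bead is either `u`, which goes to the free place, or the image of a unique old bead,
  -- whose place is kept.
  have hmem : ∀ x, ∃ p : B.Y × Fin 2, (x = u → p = (π y, 1)) ∧
      ∀ a, m.i a = x → p = (π (φ.pos a).1, (φ.pos a).2) := by
    intro x
    by_cases hx : x = u
    · exact ⟨_, fun _ => rfl, fun a ha => (hm.not_mem a (ha.trans hx)).elim⟩
    · obtain ⟨a, rfl⟩ := hm.mem x hx
      exact ⟨_, fun h => (hx h).elim, fun b hb => by rw [m.i.injective hb]⟩
  choose p hp hp' using hmem
  have hpi : ∀ a, p (m.i a) = (π (φ.pos a).1, (φ.pos a).2) := fun a => hp' _ a rfl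
  have hne : ∀ a, p (m.i a) ≠ p u := fun a h => by
    rw [hpi, hp u rfl, Prod.mk.injEq, π.apply_eq_iff_eq] at h
    exact hy a (Prod.ext h.1 h.2)
  have hinj : Function.Injective p := by
    intro x x' h
    by_cases hx : x = u <;> by_cases hx' : x' = u
    · rw [hx, hx']
    · obtain ⟨a, rfl⟩ := hm.mem x' hx'
      exact (hne a (by rw [← h, hx])).elim
    · obtain ⟨a, rfl⟩ := hm.mem x hx
      exact (hne a (by rw [h, hx'])).elim
    · obtain ⟨a, rfl⟩ := hm.mem x hx
      obtain ⟨a', rfl⟩ := hm.mem x' hx'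
      rw [hpi, hpi, Prod.mk.injEq, π.apply_eq_iff_eq] at h
      rw [φ.pos.injective (Prod.ext h.1 h.2)]
  refine ⟨⟨⟨p, hinj⟩, fun z => ?_⟩, hm.extends_iff.2 hpi, hp u rfl⟩
  obtain ⟨a, ha⟩ := φ.bottom (π.symm z)
  exact ⟨m.i a, (hpi a).trans (by rw [ha, π.apply_symm_apply])⟩

theorem extends_unique (hm : AddsBead m u π) {φ : Beads A} {ψ ψ' : Beads B} (h : Extends m φ ψ) (h' : Extends m φ ψ')
    (hu : ψ.pos u = ψ'.pos u) : ψ = ψ' := by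
  ext1
  ext1 x
  by_cases hx : x = u
  · rw [hx, hu]
  · obtain ⟨a, rfl⟩ := hm.mem x hx
    rw [hm.extends_iff.1 h, hm.extends_iff.1 h']

theorem content_of_ne {S : Type*} (hm : AddsBead m u π) {φ : Beads A} {ψ : Beads B} (h : Extends m φ ψ) (v : B.X → S)
    {y : A.Y} (hy : π y ≠ (ψ.pos u).1) :
    ψ.content v (π y) = φ.content (fun x => v (m.i x)) y := by
  have h1 := hm.extends_iff.1 h
  rcases φ.column_cases y with ⟨x, hx, h2⟩ | ⟨x, x', hx, hx'⟩
  · rw [Beads.content_one (x := x) _ hx h2,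
      Beads.content_one (x := m.i x) _ (by rw [h1, hx])]
    intro x' hx'
    have hxu : x' ≠ u := by
      rintro rfl; exact hy (by rw [hx'])
    obtain ⟨a, rfl⟩ := hm.mem x' hxu
    rw [h1, Prod.mk.injEq, π.apply_eq_iff_eq] at hx'
    exact h2 a (Prod.ext hx'.1 hx'.2)
  · rw [Beads.content_two (x := x) (x' := x') _ hx hx',
      Beads.content_two (x := m.i x) (x' := m.i x') _ (by rw [h1, hx]) (by rw [h1, hx'])]

theorem content_new {S : Type*} (hm : AddsBead m u π) {φ : Beads A} {ψ : Beads B} (h : Extends m φ ψ) (v : B.X → S)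
    {y : A.Y} (hy : ψ.pos u = (π y, 1)) :
    ∃ x, φ.content (fun x => v (m.i x)) y = Sum.inl (v x) ∧
      ψ.content v (π y) = Sum.inr (v u, v x) := by
  have h2 := (hm.pos_new h).1
  rw [hy, π.symm_apply_apply] at h2
  refine ⟨m.i (φ.bot y), Beads.content_one (x := φ.bot y) _ (φ.pos_bot y) h2,
    Beads.content_two _ ?_ hy⟩
  rw [hm.extends_iff.1 h, φ.pos_bot]

end AddsBead

/-- A morphism of `𝔇` not in `𝔇₀` factors through the addition of a single bead. -/
theorem exists_factor_of_not_isD0 {A B : FinPair} (m : A ⟶ B) (hm : ¬ IsD0 m) :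
    ∃ (u : B.X) (p : A ⟶ ⟨{x : B.X // x ≠ u}, B.Y⟩) (q : ⟨{x : B.X // x ≠ u}, B.Y⟩ ⟶ B),
      m = p ≫ q ∧ AddsBead q u (Equiv.refl _) ∧ ∀ x, q.i x = Subtype.val x := by
  -- As `ζ` is always injective, not lying in `𝔇₀` means that some bead `u` is missed by both `i`
  -- and `ζ`. All of `m` then takes place in the complement of `u`, and `u` can be added last.
  have hns : ¬ Function.Surjective m.ζ := fun h => hm ⟨m.ζ.injective, h⟩
  rw [Function.Surjective] at hns
  push Not at hns
  obtain ⟨⟨u, hu⟩, hζ⟩ := hns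
  have hζ' : ∀ p, (m.ζ p : B.X) ≠ u := fun p h => hζ p (Subtype.ext h)
  let p : A ⟶ ⟨{x : B.X // x ≠ u}, B.Y⟩ :=
    { i := ⟨fun x => ⟨m.i x, fun h => hu ⟨x, h⟩⟩, fun x x' h =>
        m.i.injective (congrArg Subtype.val h)⟩
      j := m.j
      ζ := ⟨fun p => ⟨⟨m.ζ p, hζ' p⟩, by
          rintro ⟨x, hx⟩
          exact (m.ζ p).2 ⟨x, congrArg Subtype.val hx⟩⟩, fun p p' h =>
        m.ζ.injective (Subtype.ext (congrArg (fun t => t.1.1) h))⟩ }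
  let q : (⟨{x : B.X // x ≠ u}, B.Y⟩ : FinPair) ⟶ B :=
    { i := ⟨Subtype.val, Subtype.val_injective⟩
      j := Function.Embedding.refl _
      ζ := ⟨fun p => (p.2.2 ⟨p.2.1, rfl⟩).elim, fun p => (p.2.2 ⟨p.2.1, rfl⟩).elim⟩ }
  refine ⟨u, p, q, ?_, ⟨fun _ => rfl, fun x => x.property, fun x hx => ⟨⟨x, hx⟩, rfl⟩⟩, fun _ => rfl⟩
  refine DHom.ext_of (fun _ => rfl) (fun _ => rfl) fun ε v h h' => ?_
  exact (DHom.comp_ζ_of_mem p q ε v h h').symm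

/-- The morphism `({1, …, n}, Y) ⟶ ({1, …, n + 1}, Y)` of `𝔇` given by the inclusion. -/
def succHom (n : ℕ) (Y : Type) [Finite Y] :
    (⟨Fin n, Y⟩ : FinPair) ⟶ (⟨Fin (n + 1), Y⟩ : FinPair) where
  i := ⟨Fin.succ, Fin.succ_injective n⟩
  j := Function.Embedding.refl _
  ζ := ⟨fun p => (p.2.2 ⟨p.2.1, rfl⟩).elim, fun p => (p.2.2 ⟨p.2.1, rfl⟩).elim⟩

theorem addsBead_succHom (n : ℕ) (Y : Type) [Finite Y] :
    AddsBead (succHom n Y) (0 : Fin (n + 1)) (Equiv.refl _) where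
  j_eq _ := rfl
  not_mem := Fin.succ_ne_zero
  mem _ hx := Fin.exists_succ_eq.2 hx

section Columns

variable (k : Type u) [CommRing k] {V W : Type u} [AddCommGroup V] [Module k V]
  [AddCommGroup W] [Module k W]

/-! ## Generators of the free Lie algebra and of its truncation -/

/-- The universal property gives a morphism `Lie(V) → S` whose composite with the inclusion agrees
with the identity on `V`, hence is the identity. -/
theorem FreeLie.mem_of_forall_of_mem (S : LieSubalgebra k (FreeLie k V))
    (h : ∀ v, FreeLie.of k V v ∈ S) (x : FreeLie k V) : x ∈ S := by
  let f : FreeLie k V →ₗ⁅k⁆ S :=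
    FreeLie.lift k ((FreeLie.of k V).codRestrict S.toSubmodule h)
  have h1 : S.incl.comp f = LieHom.id := FreeLie.hom_ext k fun v => by
    exact congrArg Subtype.val (FreeLie.lift_of k _ v)
  have h2 := LieHom.congr_fun h1 x
  rw [show x = (f x : FreeLie k V) from h2.symm]
  exact (f x).2

/-- The elements with this property form a Lie subalgebra containing `V`; brackets have it with
linear part zero. -/
theorem FreeLie.exists_sub_of_mem_lcs_one (x : FreeLie k V) :
    ∃ v, x - FreeLie.of k V v ∈
      LieModule.lowerCentralSeries k (FreeLie k V) (FreeLie k V) 1 := by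
  let S : LieSubalgebra k (FreeLie k V) :=
    { carrier := {x | ∃ v, x - FreeLie.of k V v ∈
        LieModule.lowerCentralSeries k (FreeLie k V) (FreeLie k V) 1}
      add_mem' := by
        rintro a b ⟨v, hv⟩ ⟨w, hw⟩
        refine ⟨v + w, ?_⟩
        rw [map_add, add_sub_add_comm]
        exact add_mem hv hw
      zero_mem' := ⟨0, by rw [map_zero, sub_zero]; exact zero_mem _⟩
      smul_mem' := by
        rintro r a ⟨v, hv⟩
        refine ⟨r • v, ?_⟩
        rw [map_smul, ← smul_sub]
        exact Submodule.smul_mem _ r hv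
      lie_mem' := by
        rintro a b - -
        refine ⟨0, ?_⟩
        rw [map_zero, sub_zero, LieModule.lowerCentralSeries_succ]
        exact LieSubmodule.lie_mem_lie (LieSubmodule.mem_top _) (LieSubmodule.mem_top _) }
  exact FreeLie.mem_of_forall_of_mem k S (fun v => ⟨v, by rw [sub_self]; exact zero_mem _⟩) x

variable (V) in
/-- The map `V → Lie_{≤2}(V)`. -/
def LieLeTwo.of : V →ₗ[k] LieLeTwo k V :=
  (LieLeTwo.mk k V : FreeLie k V →ₗ[k] LieLeTwo k V) ∘ₗ FreeLie.of k V

theorem LieLeTwo.lie_of (x : FreeLie k V) (v : V) :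
    ⁅x, LieLeTwo.of k V v⁆ = LieLeTwo.mk k V ⁅x, FreeLie.of k V v⁆ :=
  ((LieLeTwo.mk k V).map_lie x _).symm

theorem LieLeTwo.mk_lie_eq_zero (x : FreeLie k V) {y : FreeLie k V}
    (hy : y ∈ LieModule.lowerCentralSeries k (FreeLie k V) (FreeLie k V) 1) :
    LieLeTwo.mk k V ⁅x, y⁆ = 0 := by
  refine LieSubmodule.Quotient.mk_eq_zero'.2 ?_
  rw [lieGeThree, LieModule.lowerCentralSeries_succ]
  exact LieSubmodule.lie_mem_lie (LieSubmodule.mem_top _) hy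

theorem FreeLie.lie_mem_lcs_one (x y : FreeLie k V) :
    ⁅x, y⁆ ∈ LieModule.lowerCentralSeries k (FreeLie k V) (FreeLie k V) 1 := by
  rw [LieModule.lowerCentralSeries_succ]
  exact LieSubmodule.lie_mem_lie (LieSubmodule.mem_top _) (LieSubmodule.mem_top _)

/-- A bracket of length three vanishes in the truncation. On the side of beads, this says that a
column with two beads accepts no further bead. -/
theorem LieLeTwo.lie_lie_of (x y : FreeLie k V) (v : V) :
    ⁅x, ⁅y, LieLeTwo.of k V v⁆⁆ = 0 := by
  rw [LieLeTwo.lie_of, ← LieModuleHom.map_lie]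
  exact LieLeTwo.mk_lie_eq_zero k x (FreeLie.lie_mem_lcs_one k y _)

theorem LieLeTwo.lie_of_skew (v w : V) :
    ⁅FreeLie.of k V v, LieLeTwo.of k V w⁆ = -⁅FreeLie.of k V w, LieLeTwo.of k V v⁆ := by
  rw [LieLeTwo.lie_of, LieLeTwo.lie_of, ← lie_skew, map_neg]

/-- The element of `Lie_{≤2}(V)` given by the content of a column labelled in `V`. -/
def columnValue : V ⊕ V × V → LieLeTwo k V :=
  Sum.elim (LieLeTwo.of k V) fun p => ⁅FreeLie.of k V p.1, LieLeTwo.of k V p.2⁆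

theorem columnValue_inl (v : V) : columnValue k (Sum.inl v) = LieLeTwo.of k V v := rfl

theorem columnValue_inr (v w : V) :
    columnValue k (Sum.inr (v, w)) = ⁅FreeLie.of k V v, LieLeTwo.of k V w⁆ := rfl

theorem columnValue_map (f : V →ₗ[k] W) (c : V ⊕ V × V) :
    LieLeTwo.map k f (columnValue k c) = columnValue k (Sum.map f (Prod.map f f) c) := by
  have h : ∀ v, LieLeTwo.map k f (LieLeTwo.of k V v) = LieLeTwo.of k W (f v) := fun v =>
    (LieLeTwo.map_mk k f _).trans (congrArg _ (FreeLie.map_of k f v))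
  rcases c with v | ⟨v, w⟩
  · exact h v
  · rw [columnValue_inr, LieLeTwo.map_lie, h, FreeLie.map_of]
    rfl

/-- Modulo brackets an element is a vector of `V`; modulo brackets of length three, a bracket
depends only on the linear parts of its two entries. -/
theorem span_columnValue : Submodule.span k (Set.range (columnValue k (V := V))) = ⊤ := by
  rw [eq_top_iff]
  rintro x -
  obtain ⟨x, rfl⟩ := LieLeTwo.mk_surjective k x
  obtain ⟨v, hv⟩ := FreeLie.exists_sub_of_mem_lcs_one k x
  have h1 : ∀ z ∈ LieModule.lowerCentralSeries k (FreeLie k V) (FreeLie k V) 1,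
      LieLeTwo.mk k V z ∈ Submodule.span k (Set.range (columnValue k (V := V))) := by
    intro z hz
    rw [LieModule.lowerCentralSeries_succ, ← LieSubmodule.mem_toSubmodule,
      LieSubmodule.lieIdeal_oper_eq_linear_span'] at hz
    induction hz using Submodule.span_induction with
    | zero => rw [map_zero]; exact zero_mem _
    | add x y _ _ hx hy => rw [map_add]; exact add_mem hx hy
    | smul r x _ hx => rw [map_smul]; exact Submodule.smul_mem _ r hx
    | mem z hz =>
      obtain ⟨x, -, y, -, rfl⟩ := hz
      obtain ⟨v, hv⟩ := FreeLie.exists_sub_of_mem_lcs_one k x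
      obtain ⟨w, hw⟩ := FreeLie.exists_sub_of_mem_lcs_one k y
      -- Both error terms are arranged to have a sum of brackets as their second entry, so that
      -- `LieLeTwo.mk_lie_eq_zero` applies to each.
      have h2 : ⁅x, y⁆ = ⁅FreeLie.of k V v, FreeLie.of k V w⁆ +
          ⁅FreeLie.of k V v, y - FreeLie.of k V w⁆ - ⁅y, x - FreeLie.of k V v⁆ := by
        rw [← lie_skew y, lie_sub, sub_lie]
        abel
      rw [h2, map_sub, map_add, LieLeTwo.mk_lie_eq_zero k _ hw, LieLeTwo.mk_lie_eq_zero k _ hv,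
        add_zero, sub_zero]
      exact Submodule.subset_span ⟨Sum.inr (v, w), LieLeTwo.lie_of k _ w⟩
  have h3 := add_mem (h1 _ hv) (Submodule.subset_span (R := k) ⟨Sum.inl v, rfl⟩)
  rw [map_sub] at h3
  exact (sub_add_cancel (LieLeTwo.mk k V x) _) ▸ h3

/-! ## The tensor given by a labelled arrangement -/

/-- Each bead lies in exactly one column, and the value of that column is linear in its label, by
bilinearity of the bracket when there are two beads. Together with multilinearity of the tensor
product over columns, this makes `beadTensor` multilinear. -/
theorem exists_columnValue_update {A : FinPair} (φ : Beads A) (v : A.X → V)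
    [DecidableEq A.X] [DecidableEq A.Y] (x : A.X) : ∃ g : V →ₗ[k] LieLeTwo k V, ∀ a,
      (fun y => columnValue k (φ.content (Function.update v x a) y)) =
        Function.update (fun y => columnValue k (φ.content v y)) (φ.pos x).1 (g a) := by
  have hoff : ∀ y, y ≠ (φ.pos x).1 → ∀ a,
      columnValue k (φ.content (Function.update v x a) y) = columnValue k (φ.content v y) := by
    intro y hy a
    congr 1
    refine Beads.content_congr fun z hz => Function.update_of_ne ?_ _ _
    rintro rfl
    exact hy hz.symm
  suffices h : ∃ g : V →ₗ[k] LieLeTwo k V, ∀ a,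
      columnValue k (φ.content (Function.update v x a) (φ.pos x).1) = g a by
    obtain ⟨g, hg⟩ := h
    refine ⟨g, fun a => funext fun y => ?_⟩
    by_cases hy : y = (φ.pos x).1
    · rw [hy, Function.update_self, hg]
    · rw [Function.update_of_ne hy, hoff y hy]
  obtain ⟨⟨y, ε⟩, hx⟩ : ∃ p, φ.pos x = p := ⟨_, rfl⟩
  rw [hx]
  rcases φ.column_cases y with ⟨z, hz, h1⟩ | ⟨z, z', hz, hz'⟩
  · refine ⟨LieLeTwo.of k V, fun a => ?_⟩
    have h0 : ε = 0 := by
      by_contra h0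
      have h0 : ε = 1 := by omega
      exact h1 x (h0 ▸ hx)
    subst h0
    rw [Beads.content_one _ hx h1, Function.update_self, columnValue_inl]
  · have hne : z ≠ z' := by
      rintro rfl
      rw [hz] at hz'
      exact zero_ne_one (congrArg Prod.snd hz')
    fin_cases ε
    · obtain rfl : x = z := φ.pos.injective (hx.trans hz.symm)
      refine ⟨(LieModule.toEnd k (FreeLie k V) (LieLeTwo k V) (FreeLie.of k V (v z'))) ∘ₗ
        LieLeTwo.of k V, fun a => ?_⟩
      rw [Beads.content_two (y := y) _ hz hz', Function.update_self,
        Function.update_of_ne hne.symm, columnValue_inr]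
      rfl
    · obtain rfl : x = z' := φ.pos.injective (hx.trans hz'.symm)
      refine ⟨((LieModule.toEnd k (FreeLie k V) (LieLeTwo k V) :
        FreeLie k V →ₗ[k] Module.End k (LieLeTwo k V)).flip (LieLeTwo.of k V (v z))) ∘ₗ
        FreeLie.of k V, fun a => ?_⟩
      rw [Beads.content_two (y := y) _ hz hz', Function.update_self,
        Function.update_of_ne hne, columnValue_inr]
      rfl

variable (V) in
/-- The tensor in `Lie_{≤2}(V)^{⊗Y}` given by an arrangement with beads labelled in `V`. -/
def beadTensor {A : FinPair} (φ : Beads A) :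
    MultilinearMap k (fun _ : A.X => V) (⨂[k] _ : A.Y, LieLeTwo k V) where
  toFun v := PiTensorProduct.tprod k fun y => columnValue k (φ.content v y)
  map_update_add' v x a b := by
    classical
    obtain ⟨g, hg⟩ := exists_columnValue_update k φ v x
    rw [hg, hg, hg, map_add, MultilinearMap.map_update_add]
  map_update_smul' v x r a := by
    classical
    obtain ⟨g, hg⟩ := exists_columnValue_update k φ v x
    rw [hg, hg, map_smul, MultilinearMap.map_update_smul]

theorem beadTensor_apply {A : FinPair} (φ : Beads A) (v : A.X → V) :
    beadTensor k V φ v = PiTensorProduct.tprod k fun y => columnValue k (φ.content v y) := rfl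

theorem beadTensor_transport {A B : FinPair} (σ : A.X ≃ B.X) (π : A.Y ≃ B.Y) (φ : Beads A)
    (v : B.X → V) : beadTensor k V (φ.transport σ π) v =
      PiTensorProduct.reindex k (fun _ => LieLeTwo k V) π
        (beadTensor k V φ fun x => v (σ x)) := by
  rw [beadTensor_apply, beadTensor_apply, PiTensorProduct.reindex_tprod]
  congr 1
  funext y
  obtain ⟨y, rfl⟩ := π.surjective y
  rw [Beads.content_transport, π.symm_apply_apply]

theorem map_beadTensor {A : FinPair} (φ : Beads A) (f : V →ₗ[k] W) (v : A.X → V) :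
    PiTensorProduct.map (fun _ => LieLeTwo.map k f) (beadTensor k V φ v) =
      beadTensor k W φ fun x => f (v x) := by
  rw [beadTensor_apply, beadTensor_apply, PiTensorProduct.map_tprod]
  congr 1
  funext y
  rw [columnValue_map, Beads.content_comp φ v f]

-- Exchanging the two labels of a column reverses one bracket, which negates one factor of the
-- tensor. This is the anticommutativity relation of `Beads^±`.
open Classical in
theorem beadTensor_relabel_swap {A : FinPair} {φ : Beads A} (v : A.X → V) {a b : A.X}
    (hab : a ≠ b) (hcol : (φ.pos a).1 = (φ.pos b).1) :
    beadTensor k V φ v + beadTensor k V (φ.relabel (Equiv.swap a b)) v = 0 := by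
  have key : ∀ (a b : A.X) (y : A.Y), φ.pos a = (y, 0) → φ.pos b = (y, 1) →
      beadTensor k V φ v + beadTensor k V (φ.relabel (Equiv.swap a b)) v = 0 := by
    intro a b y ha hb
    have h1 : (fun z => columnValue k ((φ.relabel (Equiv.swap a b)).content v z)) =
        Function.update (fun z => columnValue k (φ.content v z)) y
          (-columnValue k (φ.content v y)) := by
      funext z
      rw [Beads.content_relabel_swap v ha hb]
      by_cases hz : z = y
      · subst hz
        rw [Function.update_self, Function.update_self, Beads.content_two v ha hb,
          columnValue_inr, columnValue_inr, LieLeTwo.lie_of_skew]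
      · rw [Function.update_of_ne hz, Function.update_of_ne hz]
    rw [beadTensor_apply, beadTensor_apply, h1, MultilinearMap.map_update_neg,
      Function.update_eq_self, add_neg_cancel]
  obtain ⟨⟨y, ε⟩, ha⟩ : ∃ p, φ.pos a = p := ⟨_, rfl⟩
  obtain ⟨⟨z, δ⟩, hb⟩ : ∃ p, φ.pos b = p := ⟨_, rfl⟩
  rw [ha, hb] at hcol
  obtain rfl : y = z := hcol
  -- Distinct beads of one column occupy different rows, so the two diagonal cases are impossible
  -- and the other two differ by exchanging the roles of `a` and `b`.
  fin_cases ε <;> fin_cases δ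
  · exact (hab (φ.pos.injective (ha.trans hb.symm))).elim
  · exact key a b y ha hb
  · rw [Equiv.swap_comm]
    exact key b a y hb ha
  · exact (hab (φ.pos.injective (ha.trans hb.symm))).elim

open Classical in
/-- Adding one bead in all possible ways corresponds to the diagonal action of its label. -/
theorem sum_beadTensor_extends {A B : FinPair} [Fintype A.Y] [DecidableEq A.Y] {m : A ⟶ B}
    {u : B.X} {π : A.Y ≃ B.Y} (hm : AddsBead m u π) (φ : Beads A) (v : B.X → V) :
    ∑ ψ with Extends m φ ψ, beadTensor k V ψ v =
      PiTensorProduct.reindex k (fun _ => LieLeTwo k V) π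
        ⁅FreeLie.of k V (v u), beadTensor k V φ fun x => v (m.i x)⁆ := by
  rw [diag_lie_def, beadTensor_apply, diagEnd_tprod, map_sum]
  -- An extension is matched with the column that receives `u`. The columns of the diagonal action
  -- that are not reached are those that already have two beads, and their terms vanish as brackets
  -- of length three.
  refine Finset.sum_of_injOn (fun ψ => π.symm (ψ.pos u).1) ?_ (fun _ _ => Finset.mem_univ _)
    ?_ ?_
  · intro ψ h ψ' h' he
    simp only [Finset.coe_filter, Finset.mem_univ, true_and, Set.mem_ofPred_eq] at h h'
    refine hm.extends_unique h h' (Prod.ext (π.symm.injective he) ?_)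
    rw [(hm.pos_new h).2, (hm.pos_new h').2]
  · intro y _ hy
    have h1 : ∃ x, φ.pos x = (y, 1) := by
      by_contra h
      obtain ⟨ψ, h2, h3⟩ := hm.exists_extends fun x hx => h ⟨x, hx⟩
      refine hy ⟨ψ, by simpa using h2, ?_⟩
      simp only [h3, Equiv.symm_apply_apply]
    obtain ⟨x, hx⟩ := h1
    rw [Beads.content_two _ (φ.pos_bot y) hx, columnValue_inr]
    rw [show (LieModule.toEnd k (FreeLie k V) (LieLeTwo k V)) (FreeLie.of k V (v u))
      ⁅FreeLie.of k V (v (m.i x)), LieLeTwo.of k V (v (m.i (φ.bot y)))⁆ = 0 from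
        LieLeTwo.lie_lie_of k _ _ _]
    rw [MultilinearMap.map_update_zero, map_zero]
  · intro ψ h
    simp only [Finset.mem_filter, Finset.mem_univ, true_and] at h
    obtain ⟨y, hy⟩ : ∃ y, ψ.pos u = (π y, 1) :=
      ⟨π.symm (ψ.pos u).1, Prod.ext (by simp) (hm.pos_new h).2⟩
    rw [hy]
    simp only [Equiv.symm_apply_apply]
    rw [beadTensor_apply, PiTensorProduct.reindex_tprod]
    congr 1
    funext z
    obtain ⟨z, rfl⟩ := π.surjective z
    rw [π.symm_apply_apply]
    by_cases hz : z = y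
    · subst hz
      obtain ⟨x, h1, h2⟩ := hm.content_new h v hy
      rw [Function.update_self, h1, h2]
      rfl
    · rw [Function.update_of_ne hz, hm.content_of_ne h]
      rw [hy]
      exact fun h => hz (π.injective h)

/-- Tensors of column values span, and every family of contents comes from an arrangement.
Statements about the whole tensor power can thus be checked on labelled arrangements. -/
theorem eq_top_of_beadTensor_mem {b : ℕ} (N : Submodule k (⨂[k] _ : Fin b, LieLeTwo k V))
    (h : ∀ (n : ℕ) (φ : Beads ⟨Fin n, Fin b⟩) (v : Fin n → V), beadTensor k V φ v ∈ N) :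
    N = ⊤ := by
  rw [eq_top_iff, ← PiTensorProduct.submodule_span_eq_top (R := k)
    (g := fun (_ : Fin b) c => columnValue k (V := V) c) fun _ => span_columnValue k,
    Submodule.span_le]
  rintro _ ⟨c, rfl⟩
  obtain ⟨n, φ, v, hv⟩ := Beads.exists_content_eq c
  obtain rfl : (fun y => φ.content v y) = c := funext hv
  exact h n φ v

end Columns

/-! ## A model of the truncated free Lie algebra -/

section Model

variable (k V : Type u) [Field k] [AddCommGroup V] [Module k V]

/-- The two-step nilpotent Lie algebra `V ⊕ V ⊗ V` with the bracket
`⁅v, w⁆ = (v ⊗ w - w ⊗ v) / 2`. -/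
def TwoStep : Type u := V × (V ⊗[k] V)

instance : AddCommGroup (TwoStep k V) := inferInstanceAs (AddCommGroup (V × (V ⊗[k] V)))

instance : Module k (TwoStep k V) := inferInstanceAs (Module k (V × (V ⊗[k] V)))

variable {V}

/-- The element `(v ⊗ w - w ⊗ v) / 2`. -/
def halfWedge : V →ₗ[k] V →ₗ[k] V ⊗[k] V :=
  (2 : k)⁻¹ • (TensorProduct.mk k V V - (TensorProduct.mk k V V).flip)

theorem halfWedge_apply (v w : V) :
    halfWedge k v w = (2 : k)⁻¹ • (v ⊗ₜ[k] w - w ⊗ₜ[k] v) := rfl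

instance : LieRing (TwoStep k V) where
  bracket x y := ((0, halfWedge k x.1 y.1) : V × (V ⊗[k] V))
  add_lie x y z := by
    change ((0, _) : V × (V ⊗[k] V)) = (0 + 0, _ + _)
    rw [add_zero, ← LinearMap.add_apply, ← map_add]
    rfl
  lie_add x y z := by
    change ((0, _) : V × (V ⊗[k] V)) = (0 + 0, _ + _)
    rw [add_zero, ← map_add]
    rfl
  lie_self x := by
    change ((0, _) : V × (V ⊗[k] V)) = 0
    rw [halfWedge_apply, sub_self, smul_zero]
    rfl
  leibniz_lie x y z := by
    change ((0, halfWedge k x.1 0) : V × (V ⊗[k] V)) =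
      (0 + 0, halfWedge k 0 z.1 + halfWedge k y.1 0)
    simp

instance : LieAlgebra k (TwoStep k V) where
  lie_smul r x y := by
    change ((0, halfWedge k x.1 (r • y.1)) : V × (V ⊗[k] V)) = (r • 0, r • halfWedge k x.1 y.1)
    rw [smul_zero, map_smul]

/-- The bracket sees only the components in `V`, and its values have zero component there. -/
theorem TwoStep.lie_lie (x y z : TwoStep k V) : ⁅x, ⁅y, z⁆⁆ = 0 := by
  change ((0, halfWedge k x.1 0) : V × (V ⊗[k] V)) = 0
  rw [map_zero]
  rfl

/-- This makes the morphism `Lie(V) → V ⊕ V ⊗ V` kill brackets of length three, hence descend to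
`Lie_{≤2}(V)`. -/
theorem TwoStep.lcs_two :
    LieModule.lowerCentralSeries k (TwoStep k V) (TwoStep k V) 2 = ⊥ := by
  rw [LieModule.lowerCentralSeries_succ, LieSubmodule.lie_eq_bot_iff]
  intro x _ m hm
  rw [LieModule.lowerCentralSeries_succ, ← LieSubmodule.mem_toSubmodule,
    LieSubmodule.lieIdeal_oper_eq_linear_span'] at hm
  induction hm using Submodule.span_induction with
  | zero => exact lie_zero x
  | add a b _ _ ha hb => rw [lie_add, ha, hb, add_zero]
  | smul r a _ ha => rw [lie_smul, ha, smul_zero]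
  | mem a ha =>
    obtain ⟨y, -, z, -, rfl⟩ := ha
    exact TwoStep.lie_lie k x y z

variable (V) in
/-- The morphism `Lie(V) → V ⊕ V ⊗ V`. -/
def FreeLie.toTwoStep : FreeLie k V →ₗ⁅k⁆ TwoStep k V :=
  FreeLie.lift k (LinearMap.inl k V (V ⊗[k] V) : V →ₗ[k] TwoStep k V)

variable (V) in
/-- The map `Lie_{≤2}(V) → V ⊕ V ⊗ V`. -/
def LieLeTwo.toTwoStep : LieLeTwo k V →ₗ[k] V × (V ⊗[k] V) :=
  (lieGeThree k V).toSubmodule.liftQ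
    ((FreeLie.toTwoStep k V : FreeLie k V →ₗ[k] TwoStep k V) : FreeLie k V →ₗ[k] V × (V ⊗[k] V))
    (by
      have h := lieModule_lcs_map_le (f := FreeLie.toTwoStep k V)
        (g := (FreeLie.toTwoStep k V : FreeLie k V →ₗ[k] TwoStep k V))
        (fun x m => ((FreeLie.toTwoStep k V).map_lie x m).symm) 2
      rw [TwoStep.lcs_two, LieSubmodule.bot_toSubmodule, Submodule.map_le_iff_le_comap] at h
      exact h)

/-- The element of `V ⊕ V ⊗ V` given by the content of a column labelled in `V`. -/
def columnTensor : V ⊕ V × V → V × (V ⊗[k] V) :=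
  Sum.elim (fun v => (v, 0)) fun p => (0, p.1 ⊗ₜ[k] p.2)

variable (V) in
/-- The signed exchange of the two beads of a column. -/
def columnFlip : Module.End k (V × (V ⊗[k] V)) :=
  LinearMap.prodMap LinearMap.id (-(TensorProduct.comm k V V).toLinearMap)

theorem columnFlip_inl (v : V) :
    columnFlip k V (columnTensor k (Sum.inl v)) = columnTensor k (Sum.inl v) := by
  simp [columnFlip, columnTensor]

theorem columnFlip_inr (v w : V) :
    columnFlip k V (columnTensor k (Sum.inr (v, w))) = -columnTensor k (Sum.inr (w, v)) := by
  simp [columnFlip, columnTensor]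

/-- The factor `1/2` in the bracket is chosen for this: passing through the Lie algebra averages a
column with its signed exchange, for columns of either kind. A one-bead column is its own average
because `2` is invertible. -/
theorem toTwoStep_columnValue [CharZero k] (c : V ⊕ V × V) :
    LieLeTwo.toTwoStep k V (columnValue k c) =
      (2 : k)⁻¹ • (columnTensor k c + columnFlip k V (columnTensor k c)) := by
  have h1 : ∀ v, FreeLie.toTwoStep k V (FreeLie.of k V v) = ((v, 0) : V × (V ⊗[k] V)) := fun v =>
    FreeLie.lift_of k _ v
  rcases c with v | ⟨v, w⟩
  · rw [columnFlip_inl, ← two_smul k, smul_smul, inv_mul_cancel₀ two_ne_zero, one_smul]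
    exact h1 v
  · rw [columnFlip_inr, columnValue_inr, LieLeTwo.lie_of]
    have h2 : FreeLie.toTwoStep k V ⁅FreeLie.of k V v, FreeLie.of k V w⁆ =
        ((0, halfWedge k v w) : V × (V ⊗[k] V)) := by
      rw [LieHom.map_lie, h1, h1]
      rfl
    refine Eq.trans h2 ?_
    rw [halfWedge_apply]
    simp [columnTensor, sub_eq_add_neg]

/-- A basis of `V ⊕ V ⊗ V` consisting of the columns labelled by the elements of a basis. -/
def columnBasis {I : Type*} (e : Module.Basis I k V) :
    Module.Basis (I ⊕ I × I) k (V × (V ⊗[k] V)) :=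
  e.prod (e.tensorProduct e)

theorem columnBasis_apply {I : Type*} (e : Module.Basis I k V) (c : I ⊕ I × I) :
    columnBasis k e c = columnTensor k (Sum.map e (Prod.map e e) c) := by
  rcases c with i | ⟨i, j⟩ <;> simp [columnBasis, columnTensor]

end Model

/-- A multilinear map that is invariant under an endomorphism of each variable is invariant
under the average of the identity and this endomorphism. -/
theorem multilinear_average {k ι M N : Type*} [Finite ι] [DecidableEq ι] [Field k] [CharZero k]
    [AddCommGroup M] [Module k M] [AddCommGroup N] [Module k N]
    (g : MultilinearMap k (fun _ : ι => M) N) (θ : Module.End k M)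
    (h : ∀ m i, g (Function.update m i (θ (m i))) = g m) (m : ι → M) :
    g (fun i => (2 : k)⁻¹ • (m i + θ (m i))) = g m := by
  have := Fintype.ofFinite ι
  -- The variables are averaged one at a time, `t` being the set of those already averaged. Each
  -- step replaces a value of `g` by half the sum of two equal values.
  have key : ∀ t : Finset ι, g (fun i => if i ∈ t then (2 : k)⁻¹ • (m i + θ (m i)) else m i) =
      g m := by
    intro t
    induction t using Finset.induction_on with
    | empty => simp
    | insert a t ha ih =>
      rw [← ih]
      set m' : ι → M := fun i => if i ∈ t then (2 : k)⁻¹ • (m i + θ (m i)) else m i with hm'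
      have h1 : m' a = m a := by simp [hm', ha]
      have h2 : (fun i => if i ∈ insert a t then (2 : k)⁻¹ • (m i + θ (m i)) else m i) =
          Function.update m' a ((2 : k)⁻¹ • (m' a + θ (m' a))) := by
        funext i
        by_cases hi : i = a
        · subst hi
          simp [h1]
        · simp [hm', hi]
      rw [h2, MultilinearMap.map_update_smul, MultilinearMap.map_update_add, h,
        Function.update_eq_self, ← two_smul k, smul_smul, inv_mul_cancel₀ two_ne_zero, one_smul]
  simpa using key Finset.univ

/-! ## The values of `H(Beads^±)` -/

section Classes

variable (k : Type u) [CommRing k] {n b : ℕ}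

/-- The class of an arrangement in the value of `H(Beads^±)`. -/
def beadClass (φ : Beads ⟨Fin n, Fin b⟩) :
    ((hFunctor k).obj (beadsPM k)).obj.obj (stdPair k n b) :=
  (hKer k (beadsPM k) (stdPair k n b).obj).mkQ
    ((beadsRel k ⟨Fin n, Fin b⟩).mkQ (Finsupp.single φ 1))

theorem beadClass_hom_ext {T : Type*} [AddCommGroup T] [Module k T]
    {f g : ((hFunctor k).obj (beadsPM k)).obj.obj (stdPair k n b) →ₗ[k] T}
    (h : ∀ φ, f (beadClass k φ) = g (beadClass k φ)) : f = g :=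
  Submodule.linearMap_qext _ (Submodule.linearMap_qext _ (beads_hom_ext k h))

theorem stdRep_beadClass (σ : Equiv.Perm (Fin n)) (π : Equiv.Perm (Fin b))
    (φ : Beads ⟨Fin n, Fin b⟩) :
    stdRep k ((hFunctor k).obj (beadsPM k)) n b (σ, π) (beadClass k φ) =
      beadClass k (φ.transport (B := ⟨Fin n, Fin b⟩) σ π) := by
  refine (congrArg (hKer k (beadsPM k) (stdPair k n b).obj).mkQ
    (beadsPMMap_cls_mk k (A := ⟨Fin n, Fin b⟩) (B := ⟨Fin n, Fin b⟩) (isoHom σ π)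
      (Finsupp.single φ 1))).trans ?_
  rw [beadsMap_isoHom]
  rfl

open Classical in
theorem beadClass_relabel_swap (φ : Beads ⟨Fin n, Fin b⟩) (a a' : Fin n) (h : a ≠ a')
    (hcol : (φ.pos a).1 = (φ.pos a').1) :
    beadClass k φ + beadClass k (φ.relabel (A := ⟨Fin n, Fin b⟩) (Equiv.swap a a')) = 0 := by
  have h1 : (beadsRel k ⟨Fin n, Fin b⟩).mkQ (Finsupp.single φ 1 +
      Finsupp.single (φ.relabel (A := ⟨Fin n, Fin b⟩) (Equiv.swap a a')) 1) = 0 := by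
    refine (Submodule.Quotient.mk_eq_zero _).2 (Submodule.subset_span ⟨φ, a, a', h, hcol, ?_⟩)
    congr!
  rw [map_add] at h1
  have h2 := congrArg (hKer k (beadsPM k) (stdPair k n b).obj).mkQ h1
  exact ((map_add _ _ _).symm.trans h2).trans (map_zero _)

-- Before passing to the quotient, this sum is the image of the class of `φ` under `m`, one of the
-- generators of `hKer`.
open Classical in
theorem sum_beadClass_extends {A : FinPair} (m : A ⟶ (⟨Fin n, Fin b⟩ : FinPair)) (hm : ¬ IsD0 m)
    (φ : Beads A) : ∑ ψ with Extends m φ ψ, beadClass k ψ = 0 := by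
  let Q := (hKer k (beadsPM k) (stdPair k n b).obj).mkQ ∘ₗ (beadsRel k ⟨Fin n, Fin b⟩).mkQ
  have h : Q (beadsMap k m (Finsupp.single φ 1)) = 0 := by
    refine (Submodule.Quotient.mk_eq_zero _).2 (Submodule.subset_span
      ⟨⟨A⟩, m, (beadsRel k A).mkQ (Finsupp.single φ 1), hm, ?_⟩)
    exact (beadsPMMap_cls_mk k m (Finsupp.single φ 1)).symm
  rw [beadsMap_single, map_sum] at h
  exact h

/-- The linear map out of a value of `H(Beads^±)` given by a function on arrangements. -/
def beadClassLift {T : Type*} [AddCommGroup T] [Module k T] (f : Beads ⟨Fin n, Fin b⟩ → T)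
    (hrel : ∀ x ∈ beadsRel k ⟨Fin n, Fin b⟩, Finsupp.linearCombination k f x = 0)
    (hext : ∀ (A : FinPair) (m : A ⟶ (⟨Fin n, Fin b⟩ : FinPair)), ¬ IsD0 m → ∀ x,
      Finsupp.linearCombination k f (beadsMap k m x) = 0) :
    ((hFunctor k).obj (beadsPM k)).obj.obj (stdPair k n b) →ₗ[k] T :=
  (hKer k (beadsPM k) (stdPair k n b).obj).liftQ
    ((beadsRel k ⟨Fin n, Fin b⟩).liftQ (Finsupp.linearCombination k f) hrel) (by
      rw [hKer, Submodule.span_le]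
      rintro _ ⟨B, m, x, hm, rfl⟩
      obtain ⟨x, rfl⟩ := (beadsRel k B.pair).mkQ_surjective x
      refine (congrArg ((beadsRel k ⟨Fin n, Fin b⟩).liftQ (Finsupp.linearCombination k f) hrel)
        (beadsPMMap_cls_mk k m x)).trans ?_
      exact hext _ m hm x)

theorem beadClassLift_beadClass {T : Type*} [AddCommGroup T] [Module k T]
    (f : Beads ⟨Fin n, Fin b⟩ → T) (hrel) (hext) (φ : Beads ⟨Fin n, Fin b⟩) :
    beadClassLift k f hrel hext (beadClass k φ) = f φ := by
  refine (Finsupp.linearCombination_single k 1 φ).trans ?_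
  rw [one_smul]

end Classes

/-! ## The comparison maps -/

section Comparison

variable (k : Type u) [Field k] {b : ℕ} {V W : Type u} [AddCommGroup V] [Module k V]
  [AddCommGroup W] [Module k W]

/-- The value of the Schur functor associated to `H(Beads^±)`. -/
abbrev BeadSchur (b : ℕ) (V : Type u) [AddCommGroup V] [Module k V] : Type u :=
  Schur k ((hFunctor k).obj (beadsPM k)) b V

variable (V) in
/-- The element of the Schur functor of `H(Beads^±)` given by an arrangement with beads labelled
in `V`. -/
def schurClass {n : ℕ} (φ : Beads ⟨Fin n, Fin b⟩) :
    MultilinearMap k (fun _ : Fin n => V) (BeadSchur k b V) :=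
  (DirectSum.lof k ℕ (fun n => SchurDeg k ((hFunctor k).obj (beadsPM k)) n b V) n ∘ₗ
    Representation.Coinvariants.mk (schurRep k ((hFunctor k).obj (beadsPM k)) n b V) ∘ₗ
    (TensorProduct.mk k _ _).flip (beadClass k φ)).compMultilinearMap (PiTensorProduct.tprod k)

theorem schurClass_apply {n : ℕ} (φ : Beads ⟨Fin n, Fin b⟩) (v : Fin n → V) :
    schurClass k V φ v =
      DirectSum.lof k ℕ (fun n => SchurDeg k ((hFunctor k).obj (beadsPM k)) n b V) n
        (Representation.Coinvariants.mk (schurRep k ((hFunctor k).obj (beadsPM k)) n b V)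
          (PiTensorProduct.tprod k v ⊗ₜ beadClass k φ)) := rfl

/-- Labelled arrangements generate the Schur functor: a map out of it is determined degree by
degree, then on pure tensors of labels and on classes of arrangements. -/
theorem beadSchur_hom_ext {T : Type*} [AddCommGroup T] [Module k T]
    {f g : BeadSchur k b V →ₗ[k] T}
    (h : ∀ (n : ℕ) (φ : Beads ⟨Fin n, Fin b⟩) (v : Fin n → V),
      f (schurClass k V φ v) = g (schurClass k V φ v)) : f = g := by
  refine DirectSum.linearMap_ext k fun n => ?_
  refine Representation.Coinvariants.hom_ext (TensorProduct.ext (PiTensorProduct.ext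
    (MultilinearMap.ext fun v => beadClass_hom_ext k fun φ => ?_)))
  exact h n φ v

/-- In the coinvariants of `𝔖_n`, a permutation acting on the arrangement can be moved to the
labels. -/
theorem schurClass_transport {n : ℕ} (φ : Beads ⟨Fin n, Fin b⟩) (σ : Equiv.Perm (Fin n))
    (v : Fin n → V) :
    schurClass k V (φ.transport (A := ⟨Fin n, Fin b⟩) (B := ⟨Fin n, Fin b⟩) σ (Equiv.refl _)) v =
      schurClass k V φ fun i => v (σ i) := by
  rw [schurClass_apply, schurClass_apply]
  congr 1
  refine Eq.trans (congrArg _ (Eq.symm ?_)) (Representation.Coinvariants.mk_self_apply _ σ _)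
  refine ((TensorProduct.map_tmul _ _ _ _).trans ?_)
  congr 1
  · refine (PiTensorProduct.reindex_tprod (R := k) (s := fun _ : Fin n => V) σ _).trans ?_
    congr 1
    funext i
    exact congrArg v (σ.apply_symm_apply i)
  · exact stdRep_beadClass k σ 1 φ

/-- Arrangements with the same contents differ by a renumbering of their beads, which the
coinvariants ignore. This lets a class be prescribed by the contents alone, without fixing the
number of beads. -/
theorem schurClass_eq_of_content {n n' : ℕ} {φ : Beads ⟨Fin n, Fin b⟩}
    {ψ : Beads ⟨Fin n', Fin b⟩} {v : Fin n → V} {w : Fin n' → V}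
    (h : ∀ y, ψ.content w y = φ.content v y) : schurClass k V ψ w = schurClass k V φ v := by
  obtain ⟨σ, rfl, rfl⟩ := Beads.exists_transport_of_content_eq (A := ⟨Fin n, Fin b⟩)
    (B := ⟨Fin n', Fin b⟩) (π := Equiv.refl (Fin b)) h
  obtain rfl : n = n' := Fin.equiv_iff_eq.1 ⟨σ⟩
  exact schurClass_transport k φ σ w

open Classical in
theorem schurClass_relabel_swap {n : ℕ} (φ : Beads ⟨Fin n, Fin b⟩) (v : Fin n → V) (a a' : Fin n)
    (h : a ≠ a') (hcol : (φ.pos a).1 = (φ.pos a').1) :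
    schurClass k V (φ.relabel (A := ⟨Fin n, Fin b⟩) (Equiv.swap a a')) v =
      -schurClass k V φ v := by
  rw [eq_neg_iff_add_eq_zero, add_comm, schurClass_apply, schurClass_apply, ← map_add, ← map_add,
    ← TensorProduct.tmul_add]
  rw [beadClass_relabel_swap k φ a a' h hcol, TensorProduct.tmul_zero, map_zero, map_zero]

open Classical in
theorem sum_schurClass_extends {n : ℕ} {A : FinPair} (m : A ⟶ (⟨Fin n, Fin b⟩ : FinPair))
    (hm : ¬ IsD0 m) (φ : Beads A) (v : Fin n → V) :
    ∑ ψ with Extends m φ ψ, schurClass k V ψ v = 0 := by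
  simp only [schurClass_apply]
  rw [← map_sum, ← map_sum, ← TensorProduct.tmul_sum, sum_beadClass_extends k m hm,
    TensorProduct.tmul_zero, map_zero, map_zero]

theorem schurMap_schurClass (f : V →ₗ[k] W) (π : Equiv.Perm (Fin b)) {n : ℕ}
    (φ : Beads ⟨Fin n, Fin b⟩) (v : Fin n → V) :
    schurMap k ((hFunctor k).obj (beadsPM k)) b f π (schurClass k V φ v) =
      schurClass k W (φ.transport (A := ⟨Fin n, Fin b⟩) (B := ⟨Fin n, Fin b⟩) (Equiv.refl _) π)
        fun i => f (v i) := by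
  rw [schurClass_apply, schurClass_apply]
  refine (DirectSum.lmap_lof _ _ _).trans ?_
  congr 1
  refine (schurDegMap_mk k _ n b f π _ _).trans ?_
  rw [PiTensorProduct.map_tprod, stdRep_beadClass]
  rfl

/-! ### From the Schur functor to Lie algebra homology -/

variable (b V) in
/-- The projection onto `H₀(Lie(V); Lie_{≤2}(V)^{⊗b})`. -/
def lieValMk : (⨂[k] _ : Fin b, LieLeTwo k V) →ₗ[k] LieVal k b V :=
  Submodule.mkQ _

theorem lieValMk_lie (x : FreeLie k V) (m : ⨂[k] _ : Fin b, LieLeTwo k V) :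
    lieValMk k b V ⁅x, m⁆ = 0 :=
  (Submodule.Quotient.mk_eq_zero _).2
    (LieSubmodule.lie_mem_lie (LieSubmodule.mem_top _) (LieSubmodule.mem_top _))

variable (V) in
/-- The linear map on tensors of labels given by an arrangement. -/
def beadLieMap {n : ℕ} (φ : Beads ⟨Fin n, Fin b⟩) : (⨂[k] _ : Fin n, V) →ₗ[k] LieVal k b V :=
  lieValMk k b V ∘ₗ PiTensorProduct.lift (beadTensor k V φ)

theorem beadLieMap_tprod {n : ℕ} (φ : Beads ⟨Fin n, Fin b⟩) (v : Fin n → V) :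
    beadLieMap k V φ (PiTensorProduct.tprod k v) = lieValMk k b V (beadTensor k V φ v) := by
  rw [beadLieMap, LinearMap.comp_apply, PiTensorProduct.lift.tprod]

theorem beadLieMap_rel {n : ℕ} (x : Beads ⟨Fin n, Fin b⟩ →₀ k)
    (hx : x ∈ beadsRel k ⟨Fin n, Fin b⟩) :
    Finsupp.linearCombination k (beadLieMap k V) x = 0 := by
  classical
  rw [beadsRel] at hx
  induction hx using Submodule.span_induction with
  | zero => rw [map_zero]
  | add x y _ _ hx hy => rw [map_add, hx, hy, add_zero]
  | smul r x _ hx => rw [map_smul, hx, smul_zero]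
  | mem x hx =>
    obtain ⟨φ, a, a', hne, hcol, rfl⟩ := hx
    rw [map_add, Finsupp.linearCombination_single, Finsupp.linearCombination_single, one_smul,
      one_smul]
    refine PiTensorProduct.ext (MultilinearMap.ext fun v => ?_)
    refine (congrArg₂ (· + ·) (beadLieMap_tprod k φ v) (beadLieMap_tprod k _ v)).trans ?_
    rw [← map_add]
    refine (congrArg _ ?_).trans (map_zero _)
    convert beadTensor_relabel_swap k v hne hcol

/-- After factoring `m`, it suffices to treat the last morphism, which adds the single bead `u`.
There the sum of tensors is the diagonal action of the label of `u`, which is zero in `H₀`. -/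
theorem beadLieMap_ext {n : ℕ} (A : FinPair) (m : A ⟶ (⟨Fin n, Fin b⟩ : FinPair))
    (hm : ¬ IsD0 m) (x : Beads A →₀ k) :
    Finsupp.linearCombination k (beadLieMap k V) (beadsMap k m x) = 0 := by
  classical
  obtain ⟨u, p, q, rfl, hq, hqi⟩ := exists_factor_of_not_isD0 m hm
  have h : Finsupp.linearCombination k (beadLieMap k V) ∘ₗ beadsMap k q = 0 := by
    refine beads_hom_ext k fun φ => ?_
    rw [LinearMap.comp_apply, beadsMap_single, map_sum, LinearMap.zero_apply]
    simp only [Finsupp.linearCombination_single, one_smul]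
    refine PiTensorProduct.ext (MultilinearMap.ext fun v => ?_)
    simp only [LinearMap.compMultilinearMap_apply, LinearMap.sum_apply]
    simp only [beadLieMap_tprod]
    rw [← map_sum]
    let _ : Fintype (FinPair.Y ⟨{x : Fin n // x ≠ u}, Fin b⟩) := inferInstanceAs (Fintype (Fin b))
    let _ : DecidableEq (FinPair.Y ⟨{x : Fin n // x ≠ u}, Fin b⟩) :=
      inferInstanceAs (DecidableEq (Fin b))
    refine (congrArg (lieValMk k b V) (sum_beadTensor_extends k hq φ v)).trans ?_
    refine (congrArg (lieValMk k b V) (LinearEquiv.congr_fun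
      (PiTensorProduct.reindex_refl (R := k) (s := fun _ : Fin b => LieLeTwo k V)) _)).trans ?_
    exact lieValMk_lie k _ _
  rw [beadsMap_comp, LinearMap.comp_apply]
  exact LinearMap.congr_fun h _

variable (b V) in
/-- The map from the Schur functor of `H(Beads^±)` to `H₀(Lie(V); Lie_{≤2}(V)^{⊗b})`. -/
def schurToLie : BeadSchur k b V →ₗ[k] LieVal k b V :=
  DirectSum.toModule k ℕ _ fun n => Representation.Coinvariants.lift _
    (TensorProduct.lift
      (beadClassLift k (beadLieMap k V) (beadLieMap_rel k) (beadLieMap_ext k (n := n))).flip)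
    fun σ => by
      refine TensorProduct.ext (PiTensorProduct.ext
        (MultilinearMap.ext fun v => beadClass_hom_ext k fun φ => ?_))
      have h1 : placeRep (k := k) (Fin n) V σ (PiTensorProduct.tprod k v) =
          PiTensorProduct.tprod k fun i => v (σ.symm i) :=
        PiTensorProduct.reindex_tprod (R := k) (s := fun _ : Fin n => V) σ v
      -- The arrangement is moved by `σ` and its labels by place permutation along `σ`, so every
      -- bead carries the same label in the same place as before.
      change beadClassLift k (beadLieMap k V) _ _ (stdRep k _ n b (σ, 1) (beadClass k φ))
        (placeRep (k := k) (Fin n) V σ (PiTensorProduct.tprod k v)) =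
        beadClassLift k (beadLieMap k V) _ _ (beadClass k φ) (PiTensorProduct.tprod k v)
      rw [stdRep_beadClass, beadClassLift_beadClass, beadClassLift_beadClass, h1,
        beadLieMap_tprod, beadLieMap_tprod]
      congr 1
      refine (beadTensor_transport k (A := ⟨Fin n, Fin b⟩) (B := ⟨Fin n, Fin b⟩) σ 1 φ _).trans ?_
      refine (LinearEquiv.congr_fun
        (PiTensorProduct.reindex_refl (R := k) (s := fun _ : Fin b => LieLeTwo k V)) _).trans ?_
      refine congrArg (beadTensor k V φ) (funext fun i => ?_)
      exact congrArg v (σ.symm_apply_apply i)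

theorem schurToLie_schurClass {n : ℕ} (φ : Beads ⟨Fin n, Fin b⟩) (v : Fin n → V) :
    schurToLie k b V (schurClass k V φ v) = lieValMk k b V (beadTensor k V φ v) := by
  rw [schurClass_apply, schurToLie, DirectSum.toModule_lof]
  refine Eq.trans ?_ (beadLieMap_tprod k φ v)
  refine (Representation.Coinvariants.lift_mk _ _ _ _).trans ?_
  exact LinearMap.congr_fun (beadClassLift_beadClass k (beadLieMap k V) _ _ φ) _

/-- Naturality is the case `π = 1` and equivariance the case `f = id`. Both are checked on this
direction only, so the basis chosen for the inverse need not be compatible with anything. -/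
theorem schurToLie_schurMap (f : V →ₗ[k] W) (π : Equiv.Perm (Fin b)) :
    schurToLie k b W ∘ₗ schurMap k ((hFunctor k).obj (beadsPM k)) b f π =
      lieValMap k b f π ∘ₗ schurToLie k b V := by
  refine beadSchur_hom_ext k fun n φ v => ?_
  rw [LinearMap.comp_apply, LinearMap.comp_apply, schurMap_schurClass, schurToLie_schurClass,
    schurToLie_schurClass]
  refine Eq.trans (congrArg _ ?_) (lieValMap_mk k b f π _).symm
  exact (beadTensor_transport k (A := ⟨Fin n, Fin b⟩) (B := ⟨Fin n, Fin b⟩) (Equiv.refl _) π φ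
    _).trans (congrArg (PiTensorProduct.reindex k (fun _ : Fin b => LieLeTwo k W) π)
      (map_beadTensor k φ f v).symm)

/-! ### From Lie algebra homology to the Schur functor -/

section Inverse

variable {I : Type*} (e : Module.Basis I k V)

/-- The element of the Schur functor of `H(Beads^±)` with prescribed contents of the columns. -/
def contentClass (c : Fin b → I ⊕ I × I) : BeadSchur k b V :=
  schurClass k V (Beads.exists_content_eq c).choose_spec.choose
    fun i => e ((Beads.exists_content_eq c).choose_spec.choose_spec.choose i)

/-- The arrangement chosen in `contentClass` does not matter, because the class depends only on the
contents. -/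
theorem contentClass_content {n : ℕ} (φ : Beads ⟨Fin n, Fin b⟩) (f : Fin n → I) :
    contentClass k e (fun y => φ.content f y) = schurClass k V φ fun i => e (f i) := by
  refine schurClass_eq_of_content k fun y => ?_
  have h := (Beads.exists_content_eq fun y => φ.content f y).choose_spec.choose_spec.choose_spec y
  exact (Beads.content_comp _ _ e y).trans
    ((congrArg _ h).trans (Beads.content_comp φ f e y).symm)

/-- On an arrangement with contents `c`, exchanging the entries of a pair amounts to transposing the
labels of the two beads of a column, which changes the sign of its class. -/
theorem contentClass_update (c : Fin b → I ⊕ I × I) (y : Fin b) (i j : I)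
    (h : c y = Sum.inr (i, j)) :
    contentClass k e (Function.update c y (Sum.inr (j, i))) = -contentClass k e c := by
  classical
  obtain ⟨n, φ, f, hf⟩ := Beads.exists_content_eq c
  obtain rfl : (fun y => φ.content f y) = c := funext hf
  replace h : φ.content f y = Sum.inr (i, j) := h
  rcases φ.column_cases y with ⟨x, hx, h1⟩ | ⟨x, x', hx, hx'⟩
  · rw [Beads.content_one f hx h1] at h
    cases h
  · rw [Beads.content_two f hx hx', Sum.inr.injEq, Prod.mk.injEq] at h
    obtain ⟨rfl, rfl⟩ := h
    have hne : x ≠ x' := by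
      rintro rfl
      exact zero_ne_one (congrArg Prod.snd (hx.symm.trans hx'))
    rw [contentClass_content, ← schurClass_relabel_swap k φ _ x x' hne (by rw [hx, hx']),
      ← contentClass_content]
    congr 1
    exact (Beads.content_relabel_swap f hx hx').symm

variable (b) in
/-- The linear map on `(V ⊕ V ⊗ V)^{⊗b}` sending a product of columns labelled in the basis to the
corresponding element of the Schur functor. -/
def contentMap : (⨂[k] _ : Fin b, V × (V ⊗[k] V)) →ₗ[k] BeadSchur k b V :=
  (Basis.piTensorProduct fun _ : Fin b => columnBasis k e).constr k (contentClass k e)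

theorem contentMap_basis (c : Fin b → I ⊕ I × I) :
    contentMap k b e (PiTensorProduct.tprod k fun y => columnBasis k e (c y)) =
      contentClass k e c := by
  rw [← Basis.piTensorProduct_apply, contentMap, Module.Basis.constr_basis]

/-- The sign in `columnFlip` compensates the sign in `contentClass_update`. This is the invariance
required by `multilinear_average`. -/
theorem contentMap_update_flip (m : Fin b → V × (V ⊗[k] V)) (y : Fin b) :
    contentMap k b e (PiTensorProduct.tprod k
      (Function.update m y (columnFlip k V (m y)))) =
        contentMap k b e (PiTensorProduct.tprod k m) := by
  -- Writing the exchange in column `y` as an endomorphism of the tensor power turns the claim into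
  -- an equality of linear maps, which can be checked on products of basis columns.
  have hupd : ∀ m : Fin b → V × (V ⊗[k] V), PiTensorProduct.map
      (Function.update (fun _ => (1 : Module.End k (V × (V ⊗[k] V)))) y (columnFlip k V))
        (PiTensorProduct.tprod k m) =
      PiTensorProduct.tprod k (Function.update m y (columnFlip k V (m y))) := by
    intro m
    rw [PiTensorProduct.map_tprod]
    congr 1
    funext z
    by_cases hz : z = y
    · subst hz
      simp
    · simp [hz]
  rw [← hupd, ← LinearMap.comp_apply]
  congr 1
  refine (Basis.piTensorProduct fun _ : Fin b => columnBasis k e).ext fun c => ?_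
  rw [LinearMap.comp_apply, Basis.piTensorProduct_apply, hupd]
  rcases hc : c y with i | ⟨i, j⟩
  · rw [columnBasis_apply, Sum.map_inl, columnFlip_inl, ← Sum.map_inl (g := Prod.map e e),
      ← columnBasis_apply, ← hc, Function.update_eq_self y fun z => columnBasis k e (c z)]
  · rw [columnBasis_apply, Sum.map_inr, Prod.map_apply, columnFlip_inr, MultilinearMap.map_update_neg,
      map_neg, contentMap_basis, ← neg_eq_iff_eq_neg.2 (contentClass_update k e c y i j hc),
      ← contentMap_basis]
    congr 3
    funext z
    by_cases hz : z = y
    · subst hz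
      rw [Function.update_self, Function.update_self, columnBasis_apply]
      rfl
    · rw [Function.update_of_ne hz, Function.update_of_ne hz]

variable (b) in
/-- The map from `Lie_{≤2}(V)^{⊗b}` to the Schur functor of `H(Beads^±)`. -/
def tensorToSchur : (⨂[k] _ : Fin b, LieLeTwo k V) →ₗ[k] BeadSchur k b V :=
  contentMap k b e ∘ₗ PiTensorProduct.map fun _ => LieLeTwo.toTwoStep k V

variable [CharZero k]

/-- Both sides are multilinear in the labels, so basis vectors suffice as labels. The columns then
become averages of basis columns with their exchanges, and the invariance of `contentMap` removes
the averaging. -/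
theorem tensorToSchur_beadTensor {n : ℕ} (φ : Beads ⟨Fin n, Fin b⟩) (v : Fin n → V) :
    tensorToSchur k b e (beadTensor k V φ v) = schurClass k V φ v := by
  suffices h : (tensorToSchur k b e).compMultilinearMap (beadTensor k V φ) = schurClass k V φ from
    congrArg (fun t => t v) h
  refine Module.Basis.ext_multilinear (fun _ => e) fun f => ?_
  rw [LinearMap.compMultilinearMap_apply, beadTensor_apply, tensorToSchur, LinearMap.comp_apply,
    PiTensorProduct.map_tprod]
  simp only [toTwoStep_columnValue]
  refine (multilinear_average
    ((contentMap k b e).compMultilinearMap (PiTensorProduct.tprod k)) (columnFlip k V)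
    (fun m y => contentMap_update_flip k e m y) _).trans ?_
  rw [← contentClass_content, ← contentMap_basis]
  refine congrArg (fun t => contentMap k b e (PiTensorProduct.tprod k t)) (funext fun y => ?_)
  rw [columnBasis_apply, Beads.content_comp φ f e]

/-- The elements of `Lie(V)` whose action is killed form a Lie subalgebra, so those of `V` suffice.
On the tensor of an arrangement, the action of `v` is the sum over the placements of one more bead,
and the corresponding sum of classes is a relation in `H(Beads^±)`. -/
theorem tensorToSchur_lie (x : FreeLie k V) (m : ⨂[k] _ : Fin b, LieLeTwo k V) :
    tensorToSchur k b e ⁅x, m⁆ = 0 := by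
  classical
  let S : LieSubalgebra k (FreeLie k V) :=
    { carrier := {x | ∀ m : ⨂[k] _ : Fin b, LieLeTwo k V, tensorToSchur k b e ⁅x, m⁆ = 0}
      add_mem' := fun {x y} hx hy m => by rw [add_lie, map_add, hx, hy, add_zero]
      zero_mem' := fun m => by rw [zero_lie, map_zero]
      smul_mem' := fun r x hx m => by rw [smul_lie, map_smul, hx]; exact smul_zero (A := BeadSchur k b V) r
      lie_mem' := fun {x y} hx hy m => by rw [lie_lie, map_sub, hx, hy, sub_zero] }
  refine FreeLie.mem_of_forall_of_mem k S (fun v => ?_) x m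
  intro m
  let D : Module.End k (⨂[k] _ : Fin b, LieLeTwo k V) :=
    LieModule.toEnd k (FreeLie k V) _ (FreeLie.of k V v)
  have hD : LinearMap.ker (tensorToSchur k b e ∘ₗ D) = ⊤ := by
    refine eq_top_of_beadTensor_mem k _ fun n φ w => ?_
    rw [LinearMap.mem_ker, LinearMap.comp_apply]
    -- In `succHom` the old beads are shifted by one and the new bead is `0`; the labelling
    -- `Fin.cons v w` gives it the label `v` and leaves the labels `w` on the old beads.
    have h1 := sum_beadTensor_extends k (A := ⟨Fin n, Fin b⟩) (addsBead_succHom n (Fin b)) φ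
      (Fin.cons v w : Fin (n + 1) → V)
    have h2 := h1.trans (LinearEquiv.congr_fun
      (PiTensorProduct.reindex_refl (R := k) (s := fun _ : Fin b => LieLeTwo k V)) _)
    have h3 := congrArg (tensorToSchur k b e) h2
    rw [map_sum] at h3
    refine Eq.trans h3.symm ?_
    exact (Finset.sum_congr rfl fun ψ _ => tensorToSchur_beadTensor k e ψ _).trans
      (sum_schurClass_extends k _ (addsBead_succHom n (Fin b)).not_isD0 φ _)
  have hm : m ∈ LinearMap.ker (tensorToSchur k b e ∘ₗ D) := by rw [hD]; trivial
  exact hm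

variable (b) in
/-- The map from `H₀(Lie(V); Lie_{≤2}(V)^{⊗b})` to the Schur functor of `H(Beads^±)`. -/
def lieToSchur : LieVal k b V →ₗ[k] BeadSchur k b V :=
  Submodule.liftQ _ (tensorToSchur k b e) (by
    rw [LieSubmodule.lieIdeal_oper_eq_linear_span', Submodule.span_le]
    rintro _ ⟨x, -, m, -, rfl⟩
    exact tensorToSchur_lie k e x m)

theorem lieToSchur_mk (m : ⨂[k] _ : Fin b, LieLeTwo k V) :
    lieToSchur k b e (lieValMk k b V m) = tensorToSchur k b e m := rfl

theorem lieToSchur_comp_schurToLie : lieToSchur k b e ∘ₗ schurToLie k b V = LinearMap.id := by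
  refine beadSchur_hom_ext k fun n φ v => ?_
  rw [LinearMap.comp_apply, schurToLie_schurClass, lieToSchur_mk, tensorToSchur_beadTensor,
    LinearMap.id_apply]

theorem schurToLie_comp_lieToSchur : schurToLie k b V ∘ₗ lieToSchur k b e = LinearMap.id := by
  refine Submodule.linearMap_qext _ ?_
  have h : LinearMap.eqLocus ((schurToLie k b V ∘ₗ lieToSchur k b e) ∘ₗ lieValMk k b V)
      (lieValMk k b V) = ⊤ := by
    refine eq_top_of_beadTensor_mem k _ fun n φ v => ?_
    rw [LinearMap.mem_eqLocus, LinearMap.comp_apply, LinearMap.comp_apply, lieToSchur_mk,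
      tensorToSchur_beadTensor, schurToLie_schurClass]
  exact LinearMap.eqLocus_eq_top.1 h

end Inverse

/-! ### The natural equivariant isomorphism -/

variable (b V) in
/-- The isomorphism between the Schur functor of `H(Beads^±)` and
`H₀(Lie(V); Lie_{≤2}(V)^{⊗b})`. -/
def schurEquivLie [CharZero k] : BeadSchur k b V ≃ₗ[k] LieVal k b V :=
  LinearEquiv.ofLinearMap (schurToLie k b V) (lieToSchur k b (Module.Basis.ofVectorSpace k V))
    (schurToLie_comp_lieToSchur k _) (lieToSchur_comp_schurToLie k _)

/-- The natural `𝔖_b`-equivariant isomorphism between the Schur functor of `H(Beads^±)` and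
`V ↦ H₀(Lie(V); Lie_{≤2}(V)^{⊗b})`. -/
def schurIsoLie [CharZero k] (b : ℕ) :
    schurFunctor k ((hFunctor k).obj (beadsPM k)) b ≅ lieH0Functor k b :=
  NatIso.ofComponents
    (fun V => Rep.mkIso (Representation.Equiv.mk (schurEquivLie k b V)
      fun π => schurToLie_schurMap k LinearMap.id π))
    fun f => Rep.hom_ext (Representation.IntertwiningMap.ext (schurToLie_schurMap k f.hom.hom 1))

end Comparison

end BabyBeads

end

theorem proposition1 (k : Type u) [Field k] [CharZero k] (b : ℕ) :
    Nonempty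
      (BabyBeads.schurFunctor k ((BabyBeads.hFunctor k).obj (BabyBeads.beadsPM k)) b ≅
        BabyBeads.lieH0Functor k b) :=
  ⟨BabyBeads.schurIsoLie k b⟩
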